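/- For a prime $p$ let $dx$ be the Haar measure on $(\mathbb{Q}_p,+)$ with $\int_{\mathbb{Z}_p}dx=1$, and for a complex-valued function $f$ on $\mathbb{Q}_p$ put $$D^{\alpha}f(x)=\frac{p^{\alpha}-1}{1-p^{-\alpha-1}}\int_{\mathbb{Q}_p}\frac{f(x)-f(y)}{|x-y|_p^{\alpha+1}}\,dy .$$ Let $\Gamma_p(x)=\frac{1-p^{x-1}}{1-p^{-x}}$ for real $x\neq 0$. For $n\ge 0$ let $f_n(x)=|x|_p^n$ on $\mathbb{Z}_p$ and $f_n(x)=0$ elsewhere; for $n\geq 1$ let $g_{-n}(x)=0$ on $\mathbb{Z}_p$ and $g_{-n}(x)=|x|_p^{-n}$ elsewhere. Put $B=-1$. Then for all sufficiently large primes $p$ there are a real constant $E=E_p$ and real sequences $(c_n)_{n\ge 0}$, $(k_n)_{n\geq 1}$ (depending on $p$) with $c_0\ne 0$ and $k_5\neq 0$ that satisfy $$c_{2n+1}=0,\qquad c_2=0,\qquad c_{2n+4}\frac{\Gamma_p(2n+5)}{\Gamma_p(2n+3)}+Bc_{2n}=Ec_{2n+2}\qquad(n\ge 0),$$ $$k_1=k_3=0,\qquad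 k_{2n}=0,\qquad k_{2n+1}\frac{\Gamma_p(-2n)}{\Gamma_p(-2n-2)}+Bk_{2n+5}=Ek_{2n+3}\qquad(n\geq 1),$$ such that the following holds. (1) Both series in $$\psi_0(x)=\sum_{n=0}^{\infty}c_nf_n(x)+\sum_{n=1}^{\infty}k_ng_{-n}(x)=\begin{cases}\sum_{n=0}^{\infty}c_n|x|_p^n & \text{if } x\in\mathbb{Z}_p\\ \sum_{n=1}^{\infty}k_n|x|_p^{-n} & \text{otherwise}\end{cases}$$ converge (absolutely) for every $x\in\mathbb{Q}_p$. (2) For every $x\in\mathbb{Q}_p$ the integral defining $D^2\psi_0(x)$ converges absolutely, and $$D^2\psi_0(x)-|x|_p^2\,\psi_0(x)=E\,\psi_0(x).$$ (3) With $\tau_{2n}=c_{2n}/c_0$ and $s_{2n+1}=k_{2n+1}/k_5$, the constants and sequences above can be chosen, for all large $p$ simultaneously, so that for each fixed $n$, as $p\to\infty$ through the primes (the implied constants may depend on $n$), $$\tau_{4n}=\frac{1}{p^{2n}}+O\Big(\frac{1}{p^{2n+2}}\Big)\ (n\ge 1),\qquad \tau_{4n+2}=\frac{nE_p}{p^{2n+2}}+O\Big(\frac{1}{p^{2n+4}}\Big)\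 (n\ge 2),$$ $$s_{4n+1}=p^{2n-2}+O(p^{2n-4})\ (n\geq 2),\qquad s_{4n+3}=nE_p\,p^{2n-2}+O(p^{2n-4})\ (n\ge 2).$$ -/

import Mathlib

open MeasureTheory Filter Asymptotics

noncomputable section

/-- The Borel sigma-algebra on the field of `p`-adic numbers. -/
instance padicMeasurableSpace (p : ℕ) [Fact p.Prime] : MeasurableSpace ℚ_[p] := borel ℚ_[p]

instance padicBorelSpace (p : ℕ) [Fact p.Prime] : BorelSpace ℚ_[p] := ⟨rfl⟩

/-- The unit ball `ℤ_p` of `ℚ_p`, as a compact set with non-empty interior. -/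
def padicUnitBall (p : ℕ) [Fact p.Prime] : TopologicalSpace.PositiveCompacts ℚ_[p] where
  carrier := Metric.closedBall 0 1
  isCompact' := isCompact_closedBall 0 1
  interior_nonempty' :=
    ⟨0, Metric.ball_subset_interior_closedBall (Metric.mem_ball_self one_pos)⟩

/-- The Haar measure `dx` of `(ℚ_p, +)`, normalized so that `ℤ_p` has measure `1`. -/
def padicHaar (p : ℕ) [Fact p.Prime] : Measure ℚ_[p] :=
  Measure.addHaarMeasure (padicUnitBall p)

/-- The integrand `y ↦ (f x - f y) / |x - y|_p ^ (α + 1)` of the `p`-adic derivative. -/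
def padicDerivIntegrand (p : ℕ) [Fact p.Prime] (α : ℝ) (f : ℚ_[p] → ℂ) (x y : ℚ_[p]) : ℂ :=
  (f x - f y) / ((‖x - y‖ ^ (α + 1) : ℝ) : ℂ)

/-- The `p`-adic derivative operator `D^α` on complex-valued functions of a `p`-adic variable. -/
def padicDeriv (p : ℕ) [Fact p.Prime] (α : ℝ) (f : ℚ_[p] → ℂ) (x : ℚ_[p]) : ℂ :=
  ((((p : ℝ) ^ α - 1) / (1 - (p : ℝ) ^ (-α - 1)) : ℝ) : ℂ) *
    ∫ y, padicDerivIntegrand p α f x y ∂(padicHaar p)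

/-- `Ψ` solves `D² Ψ + B |x|_p² Ψ = E Ψ` at every point of `ℚ_p`, the integral that defines
`D² Ψ (x)` being (absolutely) convergent for every `x`. -/
def IsPadicSchrodingerSolution (p : ℕ) [Fact p.Prime] (B E : ℝ) (Ψ : ℚ_[p] → ℂ) : Prop :=
  ∀ x : ℚ_[p],
    Integrable (padicDerivIntegrand p 2 Ψ x) (padicHaar p) ∧
    padicDeriv p 2 Ψ x + (B : ℂ) * ((‖x‖ ^ 2 : ℝ) : ℂ) * Ψ x = (E : ℂ) * Ψ x

/-- The `p`-adic Gamma function `Γ_p(x) = (1 - p^(x-1)) / (1 - p^(-x))`, `x ≠ 0`. -/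
def padicGamma (p : ℕ) (x : ℝ) : ℝ :=
  (1 - (p : ℝ) ^ (x - 1)) / (1 - (p : ℝ) ^ (-x))

/-- The function equal to `|x|_p ^ n` on `ℤ_p` and to `0` elsewhere. -/
def fPow (p : ℕ) [Fact p.Prime] (n : ℕ) (x : ℚ_[p]) : ℝ :=
  if ‖x‖ ≤ 1 then ‖x‖ ^ n else 0

/-- The function equal to `0` on `ℤ_p` and to `|x|_p ^ m` elsewhere. -/
def gPow (p : ℕ) [Fact p.Prime] (m : ℤ) (x : ℚ_[p]) : ℝ :=
  if ‖x‖ ≤ 1 then 0 else ‖x‖ ^ m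

/-- `∑_{n ≥ 0} c_n f_n(x) + ∑_{n ≥ 1} k_n g_{-n}(x)`; the second sum is indexed by `n + 1`. -/
def psiZero (p : ℕ) [Fact p.Prime] (c k : ℕ → ℝ) (x : ℚ_[p]) : ℝ :=
  (∑' n : ℕ, c n * fPow p n x) + (∑' n : ℕ, k (n + 1) * gPow p (-((n : ℤ) + 1)) x)

/-- Both series that make up `psiZero` converge (absolutely) at `x`. -/
def PsiZeroConvergesAt (p : ℕ) [Fact p.Prime] (c k : ℕ → ℝ) (x : ℚ_[p]) : Prop :=
  Summable (fun n : ℕ => c n * fPow p n x) ∧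
    Summable (fun n : ℕ => k (n + 1) * gPow p (-((n : ℤ) + 1)) x)

/-- The recursions for the coefficients `c_n` (`n ≥ 0`) and `k_n` (`n ≥ 1`). They determine all
of them from `c_0` and `k_5`; the value `k 0` plays no role. -/
structure IsCoefficientPair (p : ℕ) (B E : ℝ) (c k : ℕ → ℝ) : Prop where
  c_odd : ∀ n : ℕ, c (2 * n + 1) = 0
  c_two : c 2 = 0
  c_rec : ∀ n : ℕ,
    c (2 * n + 4) * (padicGamma p (2 * n + 5) / padicGamma p (2 * n + 3)) + B * c (2 * n)
      = E * c (2 * n + 2)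
  k_even : ∀ n : ℕ, 1 ≤ n → k (2 * n) = 0
  k_one : k 1 = 0
  k_three : k 3 = 0
  k_rec : ∀ n : ℕ, 1 ≤ n →
    k (2 * n + 1) * (padicGamma p (-2 * n) / padicGamma p (-2 * n - 2)) + B * k (2 * n + 5)
      = E * k (2 * n + 3)

/-- The filter of "`p → ∞` through the primes". -/
def largePrimes : Filter ℕ := atTop ⊓ 𝓟 {p : ℕ | p.Prime}

end

noncomputable section

/-! Put `v = 1/p`. For a radial function the strong triangle inequality turns D² at x into sums over
spheres: those inside the sphere through x carry the kernel |x|⁻³, those outside carry |y|⁻³, and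
the sphere through x contributes nothing. On powers these sums are geometric series. Inside the unit
ball D² therefore sends |x|^(2n+4) to the Gamma quotient times |x|^(2n+2), up to a constant caused
by the change of formula across the unit sphere. Outside, the inversion X ↦ 1/X reduces everything
to the same computation, with a multiple of |x|⁻³ as boundary term. The recursions cancel all other
powers, so the equation at every point, the origin included, amounts to two scalar matching
conditions (`isPadicSchrodingerSolution_of_matching`).

Both Gamma quotients equal p² w_n with 1 ≤ w_n ≤ 1 + v² (`gammaCorrection_mem`). Writing c_(2n) = vⁿ
u_n and k_(2n+3) = κ pⁿ t_n gives recursions for u and t in which E enters only through vE. For |E|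
≤ 1 both sequences are at most 2ⁿ in absolute value, which settles convergence. The unknowns are E
and κ. One condition is linear in κ; substituting its solution leaves E + R(E) = 0 with R
continuous. The leading part of R cancels because u_2 = 1/w_0 is close to 1, so |R| ≤ 100 v², and
the intermediate value theorem gives a root (`exists_matching`).

Thus E = O(p⁻²) and vE = O(v³), so the rescaled recursions are small perturbations of u_(n+2) = u_n
and t_(n+2) = t_n. Starting from (1, 0) and (0, 1), they stay near 1 in one parity and are O(v³) in
the other. In the two formulas with main term nE_p, that term is itself no larger than the permitted
error. -/

instance padicHaar_isAddHaarMeasure (p : ℕ) [Fact p.Prime] : (padicHaar p).IsAddHaarMeasure := by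
  unfold padicHaar; infer_instance

/-! ### Haar measure of p-adic balls and spheres. -/

lemma Nat.Prime.one_lt_cast_real {p : ℕ} [hp : Fact p.Prime] : (1 : ℝ) < p := by
  exact_mod_cast hp.out.one_lt

/-- Multiplication by p^(i+1) carries the large ball to ℤ_p, where the pieces are the residue
classes mod p. -/
lemma padic_closedBall_eq_iUnion (p : ℕ) [hp : Fact p.Prime] (i : ℤ) :
    Metric.closedBall (0 : ℚ_[p]) ((p : ℝ) ^ (i + 1)) =
      ⋃ a ∈ Finset.range p,
        Metric.closedBall ((a : ℚ_[p]) * (p : ℚ_[p]) ^ (-(i + 1))) ((p : ℝ) ^ i) := by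
  have hp0 : (0 : ℝ) < p := by exact_mod_cast hp.out.pos
  have hpq : (p : ℚ_[p]) ≠ 0 := by exact_mod_cast hp.out.ne_zero
  ext x
  simp only [Set.mem_iUnion, Finset.mem_range, mem_closedBall_iff_norm, sub_zero, exists_prop]
  constructor
  · intro hx
    have h1 : ‖x * (p : ℚ_[p]) ^ (i + 1)‖ ≤ 1 := by
      rw [norm_mul, Padic.norm_p_zpow, zpow_neg]
      exact mul_inv_le_one_of_le₀ hx (by positivity)
    obtain ⟨z, hz⟩ : ∃ z : ℤ_[p], (z : ℚ_[p]) = x * (p : ℚ_[p]) ^ (i + 1) := ⟨⟨_, h1⟩, rfl⟩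
    obtain ⟨n, hn, hmem⟩ := PadicInt.exists_mem_range z
    refine ⟨n, hn, ?_⟩
    rw [IsLocalRing.mem_maximalIdeal, mem_nonunits_iff, PadicInt.not_isUnit_iff,
      PadicInt.norm_def] at hmem
    rw [PadicInt.coe_sub, PadicInt.coe_natCast, hz] at hmem
    have h2 := (Padic.norm_le_pow_iff_norm_lt_pow_add_one
      (x * (p : ℚ_[p]) ^ (i + 1) - (n : ℚ_[p])) (-1)).2 (by rw [neg_add_cancel, zpow_zero]; exact hmem)
    have h3 : x - n * (p : ℚ_[p]) ^ (-(i + 1)) =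
        (x * (p : ℚ_[p]) ^ (i + 1) - n) * (p : ℚ_[p]) ^ (-(i + 1)) := by
      rw [sub_mul, mul_assoc, ← zpow_add₀ hpq]; simp
    rw [h3, norm_mul, Padic.norm_p_zpow, neg_neg]
    calc _ ≤ (p : ℝ) ^ (-1 : ℤ) * (p : ℝ) ^ (i + 1) := by gcongr
      _ = (p : ℝ) ^ i := by rw [← zpow_add₀ hp0.ne']; congr 1; ring
  · rintro ⟨n, -, hx⟩
    have h4 : ‖(n : ℚ_[p]) * (p : ℚ_[p]) ^ (-(i + 1))‖ ≤ (p : ℝ) ^ (i + 1) := by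
      rw [norm_mul, Padic.norm_p_zpow, neg_neg]
      exact mul_le_of_le_one_left (by positivity) (by simpa using Padic.norm_int_le_one (p := p) n)
    have h5 : (p : ℝ) ^ i ≤ (p : ℝ) ^ (i + 1) :=
      zpow_le_zpow_right₀ Nat.Prime.one_lt_cast_real.le (by lia)
    calc ‖x‖ = ‖(x - n * (p : ℚ_[p]) ^ (-(i + 1))) + n * (p : ℚ_[p]) ^ (-(i + 1))‖ := by
          rw [sub_add_cancel]
      _ ≤ max _ _ := IsUltrametricDist.norm_add_le_max _ _
      _ ≤ _ := max_le (hx.trans h5) h4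

lemma padicHaar_closedBall_zpow_succ (p : ℕ) [hp : Fact p.Prime] (i : ℤ) :
    padicHaar p (Metric.closedBall 0 ((p : ℝ) ^ (i + 1))) =
      p * padicHaar p (Metric.closedBall 0 ((p : ℝ) ^ i)) := by
  have hp0 : (0 : ℝ) < p := by exact_mod_cast hp.out.pos
  rw [padic_closedBall_eq_iUnion, measure_biUnion_finset]
  · simp_rw [Measure.addHaar_closedBall_center]
    simp
  · intro a ha b hb hab
    simp only [Finset.coe_range, Set.mem_Iio] at ha hb
    rw [Function.onFun, Set.disjoint_left]
    intro x hxa hxb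
    rw [mem_closedBall_iff_norm] at hxa hxb
    have h1 : ‖((a : ℚ_[p]) - b) * (p : ℚ_[p]) ^ (-(i + 1))‖ ≤ (p : ℝ) ^ i := by
      have : ((a : ℚ_[p]) - b) * (p : ℚ_[p]) ^ (-(i + 1)) =
        (x - b * (p : ℚ_[p]) ^ (-(i + 1))) - (x - a * (p : ℚ_[p]) ^ (-(i + 1))) := by ring
      rw [this, sub_eq_add_neg]
      exact (IsUltrametricDist.norm_add_le_max _ _).trans (max_le hxb (by rwa [norm_neg]))
    rw [norm_mul, Padic.norm_p_zpow, neg_neg, zpow_add_one₀ hp0.ne', mul_comm ((p : ℝ) ^ i),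
      ← mul_assoc] at h1
    -- A common point forces the digits a and b to be congruent mod p, hence equal, since both are
    -- below p.
    have h2 : ‖((a : ℚ_[p]) - b)‖ < 1 := by
      have h3 : ‖((a : ℚ_[p]) - b)‖ * p ≤ 1 := by
        by_contra h
        push Not at h
        have := (lt_mul_iff_one_lt_left (zpow_pos hp0 i)).2 h
        linarith
      have := Nat.Prime.one_lt_cast_real (p := p)
      by_contra h
      push Not at h
      nlinarith
    have h4 : ‖(((a : ℤ) - b : ℤ) : ℚ_[p])‖ < 1 := by simpa using h2
    rw [Padic.norm_intCast_lt_one_iff] at h4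
    have h5 := Int.eq_zero_of_abs_lt_dvd h4 (by rw [abs_lt]; lia)
    lia
  · intro a _
    exact Metric.isClosed_closedBall.measurableSet

lemma padicHaar_closedBall_zpow (p : ℕ) [hp : Fact p.Prime] (i : ℤ) :
    (padicHaar p).real (Metric.closedBall 0 ((p : ℝ) ^ i)) = (p : ℝ) ^ i := by
  have hp0 : (p : ℝ) ≠ 0 := by exact_mod_cast hp.out.ne_zero
  have step (j : ℤ) : (padicHaar p).real (Metric.closedBall 0 ((p : ℝ) ^ (j + 1))) =
      p * (padicHaar p).real (Metric.closedBall 0 ((p : ℝ) ^ j)) := by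
    simp [Measure.real, padicHaar_closedBall_zpow_succ]
  induction i using Int.induction_on with
  | zero =>
    have : padicHaar p (Metric.closedBall 0 1) = 1 :=
      Measure.addHaarMeasure_self (K₀ := padicUnitBall p)
    simp [Measure.real, this]
  | succ i ih => rw [step, ih, zpow_add_one₀ hp0, mul_comm]
  | pred i ih =>
    have := step (-i - 1)
    rw [sub_add_cancel, ih] at this
    refine mul_left_cancel₀ hp0 (this.symm.trans ?_)
    rw [zpow_sub_one₀ hp0]
    field_simp

lemma padicHaar_sphere_zpow (p : ℕ) [hp : Fact p.Prime] (i : ℤ) :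
    (padicHaar p).real (Metric.sphere 0 ((p : ℝ) ^ i)) = (1 - (p : ℝ)⁻¹) * (p : ℝ) ^ i := by
  have hp0 : (p : ℝ) ≠ 0 := by exact_mod_cast hp.out.ne_zero
  have h1 : Metric.sphere (0 : ℚ_[p]) ((p : ℝ) ^ i) =
      Metric.closedBall 0 ((p : ℝ) ^ i) \ Metric.closedBall 0 ((p : ℝ) ^ (i - 1)) := by
    ext x
    simp only [mem_sphere_iff_norm, sub_zero, Set.mem_sdiff, mem_closedBall_iff_norm,
      Padic.norm_le_pow_iff_norm_lt_pow_add_one x (i - 1), sub_add_cancel, not_lt]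
    exact ⟨fun h => ⟨h.le, h.ge⟩, fun h => le_antisymm h.1 h.2⟩
  have h2 : Metric.closedBall (0 : ℚ_[p]) ((p : ℝ) ^ (i - 1)) ⊆
      Metric.closedBall 0 ((p : ℝ) ^ i) :=
    Metric.closedBall_subset_closedBall
      (zpow_le_zpow_right₀ Nat.Prime.one_lt_cast_real.le (by lia))
  rw [h1, measureReal_sdiff h2 Metric.isClosed_closedBall.measurableSet
    (isCompact_closedBall _ _).measure_ne_top, padicHaar_closedBall_zpow,
    padicHaar_closedBall_zpow, zpow_sub_one₀ hp0]
  ring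

/-! ### Radial integrals and D² of radial functions. -/

/-- Integral of a radial function over `ℚ_p`. -/
lemma integral_padic_radial (p : ℕ) [hp : Fact p.Prime] {φ : ℚ_[p] → ℝ} {g : ℝ → ℝ} {I : ℝ}
    (hφ : ∀ y, y ≠ 0 → φ y = g ‖y‖)
    (hI : HasSum (fun i : ℤ => (p : ℝ) ^ i * g ((p : ℝ) ^ i)) I) :
    Integrable φ (padicHaar p) ∧ ∫ y, φ y ∂(padicHaar p) = (1 - (p : ℝ)⁻¹) * I := by
  have hp0 : (0 : ℝ) < p := by exact_mod_cast hp.out.pos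
  set s : ℤ → Set ℚ_[p] := fun i => Metric.sphere 0 ((p : ℝ) ^ i) with hs
  have hsm (i : ℤ) : MeasurableSet (s i) := Metric.isClosed_sphere.measurableSet
  have hfin (i : ℤ) : padicHaar p (s i) ≠ ⊤ := (isCompact_sphere _ _).measure_ne_top
  have hval (i : ℤ) : ∀ y ∈ s i, φ y = g ((p : ℝ) ^ i) := by
    intro y hy
    simp only [hs, mem_sphere_iff_norm, sub_zero] at hy
    rw [hφ y (norm_ne_zero_iff.1 (by rw [hy]; positivity)), hy]
  -- The spheres miss only the origin, a null set; hence the profile need not describe the integrand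
  -- there.
  have hU : (⋃ i, s i) =ᵐ[padicHaar p] Set.univ := by
    rw [ae_eq_univ]
    refine measure_mono_null (t := {0}) ?_ (measure_singleton _)
    intro y hy
    by_contra h0
    refine hy (Set.mem_iUnion.2 ⟨-y.valuation, ?_⟩)
    simp [hs, Padic.norm_eq_zpow_neg_valuation h0]
  have hint (i : ℤ) : IntegrableOn φ (s i) (padicHaar p) :=
    (integrableOn_const (hfin i)).congr_fun (fun y hy => (hval i y hy).symm) (hsm i)
  have hp1 := Nat.Prime.one_lt_cast_real (p := p)
  have hin : IntegrableOn φ (⋃ i, s i) (padicHaar p) := by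
    refine integrableOn_iUnion_of_summable_integral_norm hint ?_
    refine (hI.summable.norm.mul_left (1 - (p : ℝ)⁻¹)).congr fun i => ?_
    rw [setIntegral_congr_fun (g := fun _ => ‖g ((p : ℝ) ^ i)‖) (hsm i)
      (fun y hy => by simp only [hval i y hy]), setIntegral_const, padicHaar_sphere_zpow,
      norm_mul, Real.norm_of_nonneg (zpow_nonneg hp0.le i), smul_eq_mul]
    ring
  have hint' : Integrable φ (padicHaar p) := by
    rw [← integrableOn_univ]
    exact hin.congr_set_ae hU.symm
  refine ⟨hint', ?_⟩
  have hd : Pairwise (Function.onFun Disjoint s) := by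
    intro i j hij
    rw [Function.onFun, Set.disjoint_left]
    intro y hi hj
    simp only [hs, mem_sphere_iff_norm, sub_zero] at hi hj
    exact hij (zpow_right_injective₀ hp0 hp1.ne' (hi.symm.trans hj))
  have h1 := hasSum_integral_iUnion hsm hd hin
  rw [setIntegral_congr_set hU, setIntegral_univ] at h1
  refine h1.unique ((hI.mul_left (1 - (p : ℝ)⁻¹)).congr_fun fun i => ?_)
  rw [setIntegral_congr_fun (g := fun _ => g ((p : ℝ) ^ i)) (hsm i) (hval i),
    setIntegral_const, padicHaar_sphere_zpow, smul_eq_mul]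
  ring

lemma hasSum_int_of_nat_around {f : ℤ → ℝ} {A B : ℝ} (j : ℤ)
    (hA : HasSum (fun l : ℕ => f (j - 1 - l)) A) (hB : HasSum (fun l : ℕ => f (j + 1 + l)) B) :
    HasSum f (A + f j + B) := by
  rw [← (Equiv.addRight j).hasSum_iff]
  have h1 : HasSum (fun l : ℕ => f ((l : ℤ) + j)) (f j + B) := by
    have := (hasSum_nat_add_iff (f := fun l : ℕ => f ((l : ℤ) + j)) 1).1
      (hB.congr_fun fun l => by push_cast; congr 1; ring)
    simpa [add_comm] using this
  have := HasSum.of_nat_of_neg_add_one (f := f ∘ Equiv.addRight j) h1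
    (hA.congr_fun fun l => by simp only [Function.comp, Equiv.coe_addRight]; congr 1; ring)
  convert this using 1
  ring

/-- The constant `(p² - 1) (1 - p⁻¹) / (1 - p⁻³)`: the factor in front of `D²` times the measure
of the unit sphere. -/
def padicDerivConst (p : ℕ) : ℝ := ((p : ℝ) ^ 2 - 1) / (1 - (p : ℝ)⁻¹ ^ 3) * (1 - (p : ℝ)⁻¹)

/-- `∑_{l ≥ 1} p^{-l} + ∑_{l ≥ 1} p^{-2l}`. -/
def padicDerivDiag (p : ℕ) : ℝ :=
  (p : ℝ)⁻¹ / (1 - (p : ℝ)⁻¹) + (p : ℝ)⁻¹ ^ 2 / (1 - (p : ℝ)⁻¹ ^ 2)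

lemma padicDeriv_prefactor (p : ℕ) :
    ((p : ℝ) ^ (2 : ℝ) - 1) / (1 - (p : ℝ) ^ (-(2 : ℝ) - 1)) * (1 - (p : ℝ)⁻¹)
      = padicDerivConst p := by
  have h3 : (p : ℝ) ^ (-(2 : ℝ) - 1) = (p : ℝ)⁻¹ ^ 3 := by
    rw [show (-(2 : ℝ) - 1) = -((3 : ℕ) : ℝ) by norm_num, Real.rpow_neg (by positivity),
      Real.rpow_natCast, inv_pow]
  rw [h3, Real.rpow_two, padicDerivConst]

lemma padicDerivIntegrand_two_ofReal (p : ℕ) [hp : Fact p.Prime] (ψ : ℚ_[p] → ℝ) (x : ℚ_[p]) :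
    padicDerivIntegrand p 2 (fun y => (ψ y : ℂ)) x =
      fun y => (((ψ x - ψ y) / ‖x - y‖ ^ 3 : ℝ) : ℂ) := by
  funext y
  have h3 : ‖x - y‖ ^ ((2 : ℝ) + 1) = ‖x - y‖ ^ 3 := by
    rw [show ((2 : ℝ) + 1) = ((3 : ℕ) : ℝ) by norm_num, Real.rpow_natCast]
  simp [padicDerivIntegrand, h3]

lemma padicDeriv_two_of_hasSum (p : ℕ) [hp : Fact p.Prime] {ψ : ℚ_[p] → ℝ} {x : ℚ_[p]}
    {g : ℝ → ℝ} {I : ℝ} (hg : ∀ y, y ≠ 0 → (ψ x - ψ y) / ‖x - y‖ ^ 3 = g ‖y‖)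
    (hI : HasSum (fun i : ℤ => (p : ℝ) ^ i * g ((p : ℝ) ^ i)) I) :
    Integrable (padicDerivIntegrand p 2 (fun y => (ψ y : ℂ)) x) (padicHaar p) ∧
      padicDeriv p 2 (fun y => (ψ y : ℂ)) x = ((padicDerivConst p * I : ℝ) : ℂ) := by
  obtain ⟨h1, h2⟩ := integral_padic_radial p hg hI
  rw [padicDeriv, padicDerivIntegrand_two_ofReal]
  refine ⟨h1.ofReal, ?_⟩
  rw [integral_complex_ofReal, h2, ← padicDeriv_prefactor]
  push_cast
  ring

lemma hasSum_geometric_succ {q : ℝ} (h0 : 0 ≤ q) (h1 : q < 1) :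
    HasSum (fun l : ℕ => q ^ (l + 1)) (q / (1 - q)) := by
  simpa [pow_succ', div_eq_mul_inv] using (hasSum_geometric_of_lt_one h0 h1).mul_left q

/-- `D²` of a radial function away from the origin. -/
lemma padicDeriv_two_radial (p : ℕ) [hp : Fact p.Prime] {ψ : ℚ_[p] → ℝ} {Φ : ℝ → ℝ}
    (hψ : ∀ y, ψ y = Φ ‖y‖) {x : ℚ_[p]} (hx : x ≠ 0) {S T : ℝ}
    (hS : HasSum (fun l : ℕ => ‖x‖ * (p : ℝ)⁻¹ ^ (l + 1) * Φ (‖x‖ * (p : ℝ)⁻¹ ^ (l + 1))) S)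
    (hT : HasSum (fun l : ℕ => ((‖x‖ * (p : ℝ) ^ (l + 1)) ^ 2)⁻¹ * Φ (‖x‖ * (p : ℝ) ^ (l + 1))) T) :
    Integrable (padicDerivIntegrand p 2 (fun y => (ψ y : ℂ)) x) (padicHaar p) ∧
      padicDeriv p 2 (fun y => (ψ y : ℂ)) x =
        ((padicDerivConst p * (padicDerivDiag p * Φ ‖x‖ / ‖x‖ ^ 2 - S / ‖x‖ ^ 3 - T) : ℝ) : ℂ) := by
  have hp1 := Nat.Prime.one_lt_cast_real (p := p)
  have hp0 : (0 : ℝ) < p := by linarith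
  have hX : 0 < ‖x‖ := norm_pos_iff.2 hx
  have hv0 : 0 < (p : ℝ)⁻¹ := by positivity
  have hv1 : (p : ℝ)⁻¹ < 1 := inv_lt_one_of_one_lt₀ hp1
  have hsq (l : ℕ) : ((p : ℝ)⁻¹ ^ 2) ^ (l + 1) = (((p : ℝ) ^ (l + 1)) ^ 2)⁻¹ := by
    rw [← pow_mul, ← pow_mul, inv_pow, mul_comm]
  -- The integrand is radial about 0 although the kernel is centred at x: for ‖y‖ ≠ ‖x‖ the distance
  -- is the larger norm, and for ‖y‖ = ‖x‖ the numerator vanishes (at y = x the quotient is 0/0 =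
  -- 0).
  refine padicDeriv_two_of_hasSum p
    (g := fun r => if r = ‖x‖ then 0 else (Φ ‖x‖ - Φ r) / max ‖x‖ r ^ 3) ?_ ?_
  · intro y hy
    by_cases h : ‖y‖ = ‖x‖
    · simp [hψ, h]
    · have : ‖x - y‖ = max ‖x‖ ‖y‖ := by
        rw [sub_eq_add_neg, IsUltrametricDist.norm_add_eq_max_of_norm_ne_norm, norm_neg]
        rw [norm_neg]; exact fun h' => h h'.symm
      simp [hψ, h, this]
  · obtain ⟨j, hj⟩ : ∃ j : ℤ, ‖x‖ = (p : ℝ) ^ j := ⟨_, Padic.norm_eq_zpow_neg_valuation hx⟩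
    have hlow (l : ℕ) : (p : ℝ) ^ (j - 1 - l) = ‖x‖ * (p : ℝ)⁻¹ ^ (l + 1) := by
      rw [hj, inv_pow, ← zpow_natCast, ← zpow_neg, ← zpow_add₀ hp0.ne']
      congr 1; push_cast; ring
    have hup (l : ℕ) : (p : ℝ) ^ (j + 1 + l) = ‖x‖ * (p : ℝ) ^ (l + 1) := by
      rw [hj, ← zpow_natCast, ← zpow_add₀ hp0.ne']
      congr 1; push_cast; ring
    have hA := (((hasSum_geometric_succ hv0.le hv1).mul_left (‖x‖ * Φ ‖x‖)).sub hS).div_const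
      (‖x‖ ^ 3)
    have hB := ((hasSum_geometric_succ (q := (p : ℝ)⁻¹ ^ 2) (by positivity)
      (pow_lt_one₀ hv0.le hv1 two_ne_zero)).mul_left (Φ ‖x‖ / ‖x‖ ^ 2)).sub hT
    have := hasSum_int_of_nat_around (f := fun i : ℤ => (p : ℝ) ^ i *
      (if (p : ℝ) ^ i = ‖x‖ then 0 else (Φ ‖x‖ - Φ ((p : ℝ) ^ i)) / max ‖x‖ ((p : ℝ) ^ i) ^ 3)) j
      (hA.congr_fun fun l => ?_) (hB.congr_fun fun l => ?_)
    · convert this using 1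
      rw [padicDerivDiag, if_pos hj.symm]
      field_simp
      ring
    · have hlt : ‖x‖ * (p : ℝ)⁻¹ ^ (l + 1) < ‖x‖ :=
        mul_lt_of_lt_one_right hX (pow_lt_one₀ hv0.le hv1 (by lia))
      rw [hlow, if_neg hlt.ne, max_eq_left hlt.le]
      ring
    · have hlt : ‖x‖ < ‖x‖ * (p : ℝ) ^ (l + 1) :=
        lt_mul_of_one_lt_right hX (one_lt_pow₀ hp1 (by lia))
      rw [hup, if_neg hlt.ne', max_eq_right hlt.le, hsq]
      field_simp

/-- `D²` of a radial function at the origin. -/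
lemma padicDeriv_two_radial_zero (p : ℕ) [hp : Fact p.Prime] {ψ : ℚ_[p] → ℝ} {Φ : ℝ → ℝ}
    (hψ : ∀ y, ψ y = Φ ‖y‖) {S T : ℝ}
    (hS : HasSum (fun l : ℕ => (((p : ℝ) * (p : ℝ)⁻¹ ^ (l + 1)) ^ 2)⁻¹ *
      (Φ ((p : ℝ) * (p : ℝ)⁻¹ ^ (l + 1)) - Φ 0)) S)
    (hT : HasSum (fun l : ℕ => (((p : ℝ) ^ (l + 1)) ^ 2)⁻¹ * Φ ((p : ℝ) ^ (l + 1))) T) :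
    Integrable (padicDerivIntegrand p 2 (fun y => (ψ y : ℂ)) 0) (padicHaar p) ∧
      padicDeriv p 2 (fun y => (ψ y : ℂ)) 0 =
        ((padicDerivConst p *
          (Φ 0 * ((p : ℝ)⁻¹ ^ 2 / (1 - (p : ℝ)⁻¹ ^ 2)) - S - T) : ℝ) : ℂ) := by
  have hp1 := Nat.Prime.one_lt_cast_real (p := p)
  have hp0 : (0 : ℝ) < p := by linarith
  have hv0 : 0 < (p : ℝ)⁻¹ := by positivity
  have hv1 : (p : ℝ)⁻¹ < 1 := inv_lt_one_of_one_lt₀ hp1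
  have hsq (l : ℕ) : ((p : ℝ)⁻¹ ^ 2) ^ (l + 1) = (((p : ℝ) ^ (l + 1)) ^ 2)⁻¹ := by
    rw [← pow_mul, ← pow_mul, inv_pow, mul_comm]
  refine padicDeriv_two_of_hasSum p (g := fun r => (Φ 0 - Φ r) / r ^ 3) ?_ ?_
  · intro y hy
    simp [hψ]
  · have hpos : HasSum (fun l : ℕ => (fun i : ℤ => (p : ℝ) ^ i *
        ((Φ 0 - Φ ((p : ℝ) ^ i)) / ((p : ℝ) ^ i) ^ 3)) (-((l : ℤ) + 1) + 1)) (-S) := by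
      refine hS.neg.congr_fun fun l => ?_
      have : (p : ℝ) ^ (-((l : ℤ) + 1) + 1) = (p : ℝ) * (p : ℝ)⁻¹ ^ (l + 1) := by
        rw [zpow_add_one₀ hp0.ne', inv_pow, ← zpow_natCast, ← zpow_neg, mul_comm]
        push_cast; rfl
      simp only [this]
      field_simp
      ring
    have hneg : HasSum (fun l : ℕ => (fun i : ℤ => (p : ℝ) ^ i *
        ((Φ 0 - Φ ((p : ℝ) ^ i)) / ((p : ℝ) ^ i) ^ 3)) ((l : ℤ) + 1))
        (Φ 0 * ((p : ℝ)⁻¹ ^ 2 / (1 - (p : ℝ)⁻¹ ^ 2)) - T) := by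
      refine (((hasSum_geometric_succ (q := (p : ℝ)⁻¹ ^ 2) (by positivity)
        (pow_lt_one₀ hv0.le hv1 two_ne_zero)).mul_left (Φ 0)).sub hT).congr_fun fun l => ?_
      have : (p : ℝ) ^ ((l : ℤ) + 1) = (p : ℝ) ^ (l + 1) := by
        rw [← zpow_natCast]; push_cast; rfl
      simp only [this, hsq]
      field_simp
    -- The cut lies between radii 1 and p: the unit sphere belongs to `S`, whose radii p ·
    -- p^(-(l+1)) start at 1.
    rw [← (Equiv.addRight (1 : ℤ)).hasSum_iff]
    have := HasSum.of_nat_of_neg_add_one (f := (fun i : ℤ => (p : ℝ) ^ i *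
        ((Φ 0 - Φ ((p : ℝ) ^ i)) / ((p : ℝ) ^ i) ^ 3)) ∘ Equiv.addRight (1 : ℤ)) hneg hpos
    convert this using 1
    ring

/-! ### Power series summed over spheres, and the action of D² on them. -/

/-- Interchange of summations for a power series summed over the dilates `X v, X v², …`. -/
lemma hasSum_powerSeries_dilates {v X : ℝ} (hv0 : 0 < v) (hv1 : v < 1) (hX : 0 ≤ X) {e : ℕ → ℝ}
    {m : ℕ → ℕ} (hm : ∀ n, 1 ≤ m n) (h : Summable fun n => |e n| * (X * v) ^ m n) :
    HasSum (fun l : ℕ => ∑' n, e n * (X * v ^ (l + 1)) ^ m n)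
      (∑' n, e n * X ^ m n * v ^ m n / (1 - v ^ m n)) := by
  have hF (n l : ℕ) : e n * (X * v ^ (l + 1)) ^ m n = e n * (X * v) ^ m n * (v ^ m n) ^ l := by
    rw [← pow_mul, mul_comm (m n) l, pow_mul, mul_assoc, ← mul_pow, pow_succ]
    ring
  have hq (n : ℕ) : v ^ m n ≤ v := pow_le_of_le_one hv0.le hv1.le (by have := hm n; lia)
  -- All dilates are at most X v, so convergence there suffices. This permits X = p for a series
  -- that converges only on the unit ball.
  have hsum : Summable fun z : ℕ × ℕ => e z.1 * (X * v ^ (z.2 + 1)) ^ m z.1 := by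
    refine Summable.of_norm_bounded
      (h.mul_of_nonneg (summable_geometric_of_lt_one hv0.le hv1) (fun n => by positivity)
        fun l => by positivity) fun z => ?_
    rw [hF, norm_mul, norm_mul, Real.norm_eq_abs, Real.norm_of_nonneg (by positivity),
      Real.norm_of_nonneg (by positivity)]
    gcongr
    exact hq _
  have h1 : (∑' z : ℕ × ℕ, e z.1 * (X * v ^ (z.2 + 1)) ^ m z.1) =
      ∑' n, e n * X ^ m n * v ^ m n / (1 - v ^ m n) := by
    rw [hsum.tsum_prod]
    congr 1
    funext n
    simp only [hF]
    rw [tsum_mul_left, tsum_geometric_of_lt_one (by positivity) ((hq n).trans_lt hv1), mul_pow]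
    ring
  rw [← h1]
  have h2 := (Equiv.prodComm ℕ ℕ).hasSum_iff.2 hsum.hasSum
  exact h2.prod_fiberwise fun l =>
    (((Equiv.prodComm ℕ ℕ).summable_iff.2 hsum).prod_factor l).hasSum

/-- `∑ eₙ X²ⁿ`. -/
def evenSeries (e : ℕ → ℝ) (X : ℝ) : ℝ := ∑' n, e n * X ^ (2 * n)

/-- `∑ eₙ X²ⁿ⁺¹ v²ⁿ⁺¹ / (1 - v²ⁿ⁺¹)`. -/
def lowSeries (v : ℝ) (e : ℕ → ℝ) (X : ℝ) : ℝ :=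
  ∑' n, e n * X ^ (2 * n + 1) * v ^ (2 * n + 1) / (1 - v ^ (2 * n + 1))

/-- `∑ eₙ₊₂ X²ⁿ⁺² / (1 - v²ⁿ⁺²)`. -/
def highSeries (v : ℝ) (e : ℕ → ℝ) (X : ℝ) : ℝ :=
  ∑' n, e (n + 2) * X ^ (2 * n + 2) / (1 - v ^ (2 * n + 2))

/-- The factor by which `v² Γ(2n+5) / Γ(2n+3)` differs from `1`. -/
def gammaCorrection (v : ℝ) (n : ℕ) : ℝ :=
  (1 - v ^ (2 * n + 4)) * (1 - v ^ (2 * n + 3)) / ((1 - v ^ (2 * n + 2)) * (1 - v ^ (2 * n + 5)))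

lemma one_sub_pow_pos {v : ℝ} (hv0 : 0 < v) (hv1 : v < 1) {n : ℕ} (hn : n ≠ 0) :
    0 < 1 - v ^ n := sub_pos.2 (pow_lt_one₀ hv0.le hv1 hn)

lemma summable_evenSeries {e : ℕ → ℝ} {X₀ X : ℝ} (h : Summable fun n => |e n| * X₀ ^ (2 * n))
    (hX : 0 ≤ X) (hXX : X ≤ X₀) : Summable fun n => e n * X ^ (2 * n) := by
  refine Summable.of_norm_bounded h fun n => ?_
  rw [norm_mul, Real.norm_eq_abs, Real.norm_of_nonneg (by positivity)]
  gcongr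

lemma Summable.mul_evenSeries {e q : ℕ → ℝ} {X₀ X C : ℝ} (k j : ℕ)
    (h : Summable fun n => |e n| * X₀ ^ (2 * n))
    (hX : 0 ≤ X) (hX₀ : 0 < X₀) (hXX : X ≤ X₀) (hq : ∀ n, |q n| ≤ C) :
    Summable fun n => e (n + k) * X ^ (2 * n + j) * q n := by
  refine Summable.of_norm_bounded
    (((summable_nat_add_iff k).2 h).mul_left (C * X ^ j / X₀ ^ (2 * k))) fun n => ?_
  have hC : 0 ≤ C := (abs_nonneg _).trans (hq 0)
  rw [norm_mul, norm_mul, Real.norm_eq_abs, Real.norm_of_nonneg (by positivity), Real.norm_eq_abs]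
  calc |e (n + k)| * X ^ (2 * n + j) * |q n|
      ≤ |e (n + k)| * (X₀ ^ (2 * n) * X ^ j) * C := by
        rw [pow_add]
        gcongr
        exact hq n
    _ = _ := by
        rw [mul_add, pow_add X₀]
        field_simp

section

variable {v : ℝ} {e : ℕ → ℝ} {X₀ X : ℝ}

lemma summable_highSeries (hv0 : 0 < v) (hv1 : v < 1)
    (h : Summable fun n => |e n| * X₀ ^ (2 * n)) (hX : 0 ≤ X) (hX₀ : 0 < X₀) (hXX : X ≤ X₀) :
    Summable fun n => e (n + 2) * X ^ (2 * n + 2) / (1 - v ^ (2 * n + 2)) := by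
  simp_rw [div_eq_mul_inv]
  refine h.mul_evenSeries 2 2 hX hX₀ hXX (C := (1 - v)⁻¹) fun n => ?_
  have := one_sub_pow_pos hv0 hv1 (n := 2 * n + 2) (by lia)
  rw [abs_of_pos (by positivity)]
  gcongr
  exact pow_le_of_le_one hv0.le hv1.le (by lia)

lemma summable_lowSeries (hv0 : 0 < v) (hv1 : v < 1)
    (h : Summable fun n => |e n| * X₀ ^ (2 * n)) (hX : 0 ≤ X) (hX₀ : 0 < X₀) (hXX : X ≤ X₀) :
    Summable fun n => e n * X ^ (2 * n + 1) * v ^ (2 * n + 1) / (1 - v ^ (2 * n + 1)) := by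
  simp_rw [mul_div_assoc]
  refine h.mul_evenSeries 0 1 hX hX₀ hXX (C := (1 - v)⁻¹) fun n => ?_
  have h1 := one_sub_pow_pos hv0 hv1 (n := 2 * n + 1) (by lia)
  rw [abs_of_pos (by positivity), div_eq_mul_inv]
  refine (mul_le_of_le_one_left (by positivity) (pow_le_one₀ hv0.le hv1.le)).trans ?_
  gcongr
  exact pow_le_of_le_one hv0.le hv1.le (by lia)

lemma hasSum_lowSeries (hv0 : 0 < v) (hv1 : v < 1)
    (h : Summable fun n => |e n| * X₀ ^ (2 * n)) (hX : 0 ≤ X) (hX₀ : 0 < X₀) (hXX : X * v ≤ X₀) :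
    HasSum (fun l : ℕ => X * v ^ (l + 1) * evenSeries e (X * v ^ (l + 1)))
      (lowSeries v e X) := by
  have := hasSum_powerSeries_dilates hv0 hv1 hX (e := e) (m := fun n => 2 * n + 1)
    (fun n => by lia) (by
      have := (Summable.mul_evenSeries (e := fun n => |e n|) (q := fun _ => 1) (C := 1) 0 1
        (by simpa using h) (by positivity : 0 ≤ X * v) hX₀ hXX (by simp))
      simpa using this)
  refine this.congr_fun fun l => ?_
  rw [evenSeries, ← tsum_mul_left]
  congr 1
  funext n
  ring

lemma evenSeries_eq_add_two (h1 : e 1 = 0) (h : Summable fun n => |e n| * X₀ ^ (2 * n))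
    (hX : 0 ≤ X) (hXX : X ≤ X₀) :
    evenSeries e X = e 0 + X ^ 2 * ∑' n, e (n + 2) * X ^ (2 * n + 2) := by
  rw [evenSeries, ← (summable_evenSeries h hX hXX).sum_add_tsum_nat_add 2, ← tsum_mul_left]
  simp only [Finset.sum_range_succ, Finset.sum_range_zero, h1]
  simp only [mul_zero, pow_zero, mul_one, zero_mul, zero_add, add_zero, add_right_inj]
  congr 1
  funext n
  ring

/-- Passing from radius X to v X adds one sphere to the outward sum, with term Φ(X)/X². The closed
expression obeys the same recurrence, so it differs from the true outward sum by a constant. The X²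
coefficient must vanish because X² · X⁻² has ratio 1, and the denominator 1 − v⁰ would be zero. -/
lemma highSeries_dilate (hv0 : 0 < v) (hv1 : v < 1) (he : e 1 = 0)
    (h : Summable fun n => |e n| * X₀ ^ (2 * n)) (hX : 0 < X) (hXX : X ≤ X₀) :
    e 0 * (v ^ 2 / (1 - v ^ 2)) / (v * X) ^ 2 - highSeries v e (v * X) =
      e 0 * (v ^ 2 / (1 - v ^ 2)) / X ^ 2 - highSeries v e X + evenSeries e X / X ^ 2 := by
  have hX₀ := hX.trans_le hXX
  have h3 : highSeries v e (v * X) = highSeries v e X - ∑' n, e (n + 2) * X ^ (2 * n + 2) := by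
    rw [highSeries, highSeries, ← (summable_highSeries hv0 hv1 h hX.le hX₀ hXX).tsum_sub]
    · congr 1
      funext n
      have := (one_sub_pow_pos hv0 hv1 (n := 2 * n + 2) (by lia)).ne'
      field_simp
      ring
    · simpa using h.mul_evenSeries (q := fun _ => 1) (C := 1) 2 2 hX.le hX₀ hXX (by simp)
  rw [evenSeries_eq_add_two he h hX.le hXX, h3]
  have := (one_sub_pow_pos hv0 hv1 (n := 2) (by lia)).ne'
  field_simp
  ring

/-- The action of `D²` on a series of even powers. -/
lemma evenSeries_derivative (hv0 : 0 < v) (hv1 : v < 1) (he : e 1 = 0)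
    (h : Summable fun n => |e n| * X₀ ^ (2 * n)) (hX : 0 < X) (hXX : X ≤ X₀) :
    (v⁻¹ ^ 2 - 1) / (1 - v ^ 3) * (1 - v) *
      ((v / (1 - v) + v ^ 2 / (1 - v ^ 2)) * evenSeries e X / X ^ 2 - lowSeries v e X / X ^ 3 -
        (e 0 * (v ^ 2 / (1 - v ^ 2)) / X ^ 2 - highSeries v e X)) =
      ∑' n, e (n + 2) * (v⁻¹ ^ 2 * gammaCorrection v n) * X ^ (2 * n + 2) := by
  have hX₀ := hX.trans_le hXX
  have d1 := (one_sub_pow_pos hv0 hv1 (n := 1) (by lia)).ne'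
  have d2 := (one_sub_pow_pos hv0 hv1 (n := 2) (by lia)).ne'
  have d3 := (one_sub_pow_pos hv0 hv1 (n := 3) (by lia)).ne'
  rw [pow_one] at d1
  have s1 := summable_evenSeries h hX.le hXX
  have s2 := summable_lowSeries hv0 hv1 h hX.le hX₀ hXX
  have s3 := summable_highSeries hv0 hv1 h hX.le hX₀ hXX
  have s1' := (summable_nat_add_iff 2).2 s1
  have s2' := (summable_nat_add_iff 2).2 s2
  rw [evenSeries, lowSeries, highSeries, ← s1.sum_add_tsum_nat_add 2, ← s2.sum_add_tsum_nat_add 2]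
  -- Termwise: the diagonal, inward and outward contributions to the power X^(2n+4) combine to v⁻²
  -- w_n. The constant term cancels, since D² annihilates constants.
  have key : (∑' n, e (n + 2) * (v⁻¹ ^ 2 * gammaCorrection v n) * X ^ (2 * n + 2)) =
      (v⁻¹ ^ 2 - 1) / (1 - v ^ 3) * (1 - v) *
      ((v / (1 - v) + v ^ 2 / (1 - v ^ 2)) / X ^ 2 * (∑' n, e (n + 2) * X ^ (2 * (n + 2))) -
        1 / X ^ 3 * (∑' n, e (n + 2) * X ^ (2 * (n + 2) + 1) * v ^ (2 * (n + 2) + 1) /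
          (1 - v ^ (2 * (n + 2) + 1))) +
        ∑' n, e (n + 2) * X ^ (2 * n + 2) / (1 - v ^ (2 * n + 2))) := by
    rw [← tsum_mul_left, ← tsum_mul_left, ← (s1'.mul_left _).tsum_sub (s2'.mul_left _),
      ← ((s1'.mul_left _).sub (s2'.mul_left _)).tsum_add s3, ← tsum_mul_left]
    congr 1
    funext n
    have e1 := (one_sub_pow_pos hv0 hv1 (n := 2 * n + 2) (by lia)).ne'
    have e2 := (one_sub_pow_pos hv0 hv1 (n := 2 * n + 5) (by lia)).ne'
    rw [gammaCorrection, show 2 * (n + 2) + 1 = 2 * n + 5 by ring,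
      show 2 * (n + 2) = 2 * n + 4 by ring]
    have p3 : v ^ (2 * n + 3) = v ^ (2 * n + 2) * v := by ring
    have p4 : v ^ (2 * n + 4) = v ^ (2 * n + 2) * v ^ 2 := by ring
    have p5 : v ^ (2 * n + 5) = v ^ (2 * n + 2) * v ^ 3 := by ring
    have q4 : X ^ (2 * n + 4) = X ^ (2 * n + 2) * X ^ 2 := by ring
    have q5 : X ^ (2 * n + 5) = X ^ (2 * n + 2) * X ^ 3 := by ring
    rw [p5, mul_comm] at e2
    rw [p3, p4, p5, q4, q5]
    generalize v ^ (2 * n + 2) = u at *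
    generalize X ^ (2 * n + 2) = Z at *
    field_simp
    ring
  rw [key]
  simp only [Finset.sum_range_succ, Finset.sum_range_zero, he]
  simp only [mul_zero, pow_zero, mul_one, zero_mul, zero_add, add_zero, zero_div, pow_one]
  field_simp
  ring

end

/-! ### Gluing the inner and outer series across the unit sphere. -/

/-- The radial profile with inner series `∑ aₙ X²ⁿ` and outer series `∑ eₙ X¹⁻²ⁿ`. -/
def radialProfile (a e : ℕ → ℝ) (X : ℝ) : ℝ :=
  if X ≤ 1 then evenSeries a X else X * evenSeries e X⁻¹

lemma evenSeries_zero (a : ℕ → ℝ) : evenSeries a 0 = a 0 := by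
  rw [evenSeries, tsum_eq_single 0 fun n hn => by simp [hn]]
  simp

section

variable {v : ℝ} {a e : ℕ → ℝ}

/-- Outward sums cross the unit sphere, so the inner power series alone does not give them. Only the
sum at radius 1 has to be known; moving inwards one sphere at a time preserves the defect c. -/
lemma hasSum_outward_of_inside (hv0 : 0 < v) (hv1 : v < 1) (ha : a 1 = 0)
    (sa : Summable fun n => |a n| * 1 ^ (2 * n)) {c : ℝ}
    (h0 : HasSum (fun l : ℕ => ((1 * v⁻¹ ^ (l + 1)) ^ 2)⁻¹ *
      radialProfile a e (1 * v⁻¹ ^ (l + 1)))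
      (c + (a 0 * (v ^ 2 / (1 - v ^ 2)) / 1 ^ 2 - highSeries v a 1))) (j : ℕ) :
    HasSum (fun l : ℕ => ((v ^ j * v⁻¹ ^ (l + 1)) ^ 2)⁻¹ *
      radialProfile a e (v ^ j * v⁻¹ ^ (l + 1)))
      (c + (a 0 * (v ^ 2 / (1 - v ^ 2)) / (v ^ j) ^ 2 - highSeries v a (v ^ j))) := by
  induction j with
  | zero => simpa only [pow_zero] using h0
  | succ j ih =>
    have hle : v ^ j ≤ 1 := pow_le_one₀ hv0.le hv1.le
    have hd := highSeries_dilate hv0 hv1 ha sa (pow_pos hv0 j) hle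
    rw [← pow_succ'] at hd
    have := (hasSum_nat_add_iff (f := fun l : ℕ => ((v ^ (j + 1) * v⁻¹ ^ (l + 1)) ^ 2)⁻¹ *
      radialProfile a e (v ^ (j + 1) * v⁻¹ ^ (l + 1))) 1).1
      (ih.congr_fun fun l => by
        have : v ^ (j + 1) * v⁻¹ ^ (l + 1 + 1) = v ^ j * v⁻¹ ^ (l + 1) := by
          rw [pow_succ v j, pow_succ' v⁻¹ (l + 1), mul_assoc, mul_inv_cancel_left₀ hv0.ne']
        rw [this])
    refine (congrArg (HasSum _ · _) ?_).mpr this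
    rw [hd]
    simp only [Finset.sum_range_succ, Finset.sum_range_zero]
    have : v ^ (j + 1) * v⁻¹ ^ (0 + 1) = v ^ j := by
      rw [zero_add, pow_one, pow_succ, mul_inv_cancel_right₀ hv0.ne']
    rw [this, radialProfile, if_pos hle]
    ring

/-- Mirror image under inversion: here inward sums cross the unit sphere, and the defect d is fixed
at radius p, the first sphere outside. -/
lemma hasSum_inward_of_outside (hv0 : 0 < v) (hv1 : v < 1) (he0 : e 0 = 0) (he : e 1 = 0)
    (se : Summable fun n => |e n| * v ^ (2 * n)) {d : ℝ}
    (h0 : HasSum (fun l : ℕ => v⁻¹ * v ^ (l + 1) * radialProfile a e (v⁻¹ * v ^ (l + 1)))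
      (d - highSeries v e v)) (j : ℕ) :
    HasSum (fun l : ℕ => (v ^ (j + 1))⁻¹ * v ^ (l + 1) *
      radialProfile a e ((v ^ (j + 1))⁻¹ * v ^ (l + 1)))
      (d - highSeries v e (v ^ (j + 1))) := by
  induction j with
  | zero => simpa only [zero_add, pow_one] using h0
  | succ j ih =>
    have hlt : v ^ (j + 1) < 1 := pow_lt_one₀ hv0.le hv1 (by lia)
    have hle : v ^ (j + 1) ≤ v := pow_le_of_le_one hv0.le hv1.le (by lia)
    have hd := highSeries_dilate hv0 hv1 he se (pow_pos hv0 (j + 1)) hle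
    rw [← pow_succ', he0] at hd
    have := (hasSum_nat_add_iff (f := fun l : ℕ => (v ^ (j + 1 + 1))⁻¹ * v ^ (l + 1) *
      radialProfile a e ((v ^ (j + 1 + 1))⁻¹ * v ^ (l + 1))) 1).1
      (ih.congr_fun fun l => by
        have : (v ^ (j + 1 + 1))⁻¹ * v ^ (l + 1 + 1) = (v ^ (j + 1))⁻¹ * v ^ (l + 1) := by
          field_simp
          ring
        rw [this])
    refine (congrArg (HasSum _ · _) ?_).mpr this
    rw [show d - highSeries v e (v ^ (j + 1 + 1)) = d +
      (0 * (v ^ 2 / (1 - v ^ 2)) / (v ^ (j + 1 + 1)) ^ 2 - highSeries v e (v ^ (j + 1 + 1))) by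
        ring, hd]
    simp only [Finset.sum_range_succ, Finset.sum_range_zero]
    have : (v ^ (j + 1 + 1))⁻¹ * v ^ (0 + 1) = (v ^ (j + 1))⁻¹ := by field_simp; ring
    rw [this, radialProfile, if_neg (not_le.2 ((one_lt_inv₀ (by positivity)).2 hlt)), inv_inv]
    ring

end

/-- Two matching conditions turn a pair of coefficient sequences into a solution. -/
theorem isPadicSchrodingerSolution_of_matching (p : ℕ) [hp : Fact p.Prime] {E : ℝ} {a e : ℕ → ℝ}
    (ha1 : a 1 = 0) (he0 : e 0 = 0) (he1 : e 1 = 0) (he2 : e 2 = 0)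
    (ra : ∀ n, a (n + 2) * ((p : ℝ) ^ 2 * gammaCorrection (p : ℝ)⁻¹ n) = E * a (n + 1) + a n)
    (re : ∀ n, e (n + 2) * ((p : ℝ) ^ 2 * gammaCorrection (p : ℝ)⁻¹ n) =
      e (n + 4) + E * e (n + 3))
    (sa : Summable fun n => |a n|) (se : Summable fun n => |e n| * (p : ℝ)⁻¹ ^ (2 * n))
    (inner : padicDerivConst p * (lowSeries (p : ℝ)⁻¹ e 1 -
      a 0 * ((p : ℝ)⁻¹ ^ 2 / (1 - (p : ℝ)⁻¹ ^ 2)) + highSeries (p : ℝ)⁻¹ a 1) = -(E * a 0))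
    (outer : padicDerivConst p * (lowSeries (p : ℝ)⁻¹ a p + highSeries (p : ℝ)⁻¹ e (p : ℝ)⁻¹) =
      -e 3)
    {ψ : ℚ_[p] → ℝ} (hψ : ∀ y, ψ y = radialProfile a e ‖y‖) :
    IsPadicSchrodingerSolution p (-1) E (fun x => (ψ x : ℂ)) := by
  have hp1 := Nat.Prime.one_lt_cast_real (p := p)
  have hp0 : (0 : ℝ) < p := by linarith
  obtain ⟨v, hv⟩ : ∃ v, v = (p : ℝ)⁻¹ := ⟨_, rfl⟩
  have hvp : (p : ℝ) = v⁻¹ := by rw [hv, inv_inv]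
  have hv0 : 0 < v := by rw [hv]; positivity
  have hv1 : v < 1 := hv ▸ inv_lt_one_of_one_lt₀ hp1
  have hK : padicDerivConst p = (v⁻¹ ^ 2 - 1) / (1 - v ^ 3) * (1 - v) := by
    rw [padicDerivConst, ← hv, hvp]
  have hγ : padicDerivDiag p = v / (1 - v) + v ^ 2 / (1 - v ^ 2) := by
    rw [padicDerivDiag, ← hv]
  rw [← hv] at inner outer se
  simp_rw [← hv, hvp] at ra re
  replace sa : Summable fun n => |a n| * 1 ^ (2 * n) := by simpa using sa
  -- sums over the spheres outside and inside the unit ball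
  have hT1 : HasSum (fun l : ℕ => ((1 * v⁻¹ ^ (l + 1)) ^ 2)⁻¹ *
      radialProfile a e (1 * v⁻¹ ^ (l + 1))) (lowSeries v e 1) := by
    refine (hasSum_lowSeries hv0 hv1 se zero_le_one hv0 (one_mul v).le).congr_fun fun l => ?_
    have : 1 < 1 * v⁻¹ ^ (l + 1) := by
      rw [one_mul]; exact one_lt_pow₀ (hvp ▸ hp1) (by lia)
    rw [radialProfile, if_neg (not_le.2 this)]
    simp only [one_mul, inv_pow, inv_inv]
    field_simp
  have hSp : HasSum (fun l : ℕ => v⁻¹ * v ^ (l + 1) * radialProfile a e (v⁻¹ * v ^ (l + 1)))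
      (lowSeries v a p) := by
    refine (hasSum_lowSeries hv0 hv1 sa hp0.le one_pos
      (by rw [hvp, inv_mul_cancel₀ hv0.ne'])).congr_fun fun l => ?_
    have : v⁻¹ * v ^ (l + 1) ≤ 1 := by
      rw [pow_succ', inv_mul_cancel_left₀ hv0.ne']; exact pow_le_one₀ hv0.le hv1.le
    rw [radialProfile, if_pos this, hvp]
  intro x
  by_cases hx : x = 0
  · subst hx
    have hS0 : HasSum (fun l : ℕ => (((p : ℝ) * (p : ℝ)⁻¹ ^ (l + 1)) ^ 2)⁻¹ *
        (radialProfile a e ((p : ℝ) * (p : ℝ)⁻¹ ^ (l + 1)) - radialProfile a e 0))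
        (highSeries v a 1) := by
      rw [hvp, inv_inv]
      have := hasSum_powerSeries_dilates hv0 hv1 (X := v⁻¹) (by positivity)
        (e := fun n => a (n + 2)) (m := fun n => 2 * n + 2) (fun n => by lia) (by
          rw [inv_mul_cancel₀ hv0.ne']
          simpa using (summable_nat_add_iff 2).2 sa)
      convert this using 1
      · funext l
        have hle : v⁻¹ * v ^ (l + 1) ≤ 1 := by
          rw [pow_succ', inv_mul_cancel_left₀ hv0.ne']; exact pow_le_one₀ hv0.le hv1.le
        rw [radialProfile, if_pos hle, radialProfile, if_pos zero_le_one, evenSeries_zero,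
          evenSeries_eq_add_two ha1 sa (by positivity) hle]
        field_simp
        ring
      · rw [highSeries]
        congr 1
        funext n
        rw [mul_assoc, ← mul_pow, inv_mul_cancel₀ hv0.ne', one_pow, mul_one]
    obtain ⟨h1, h2⟩ := padicDeriv_two_radial_zero p hψ hS0
      (by simpa only [hvp, one_mul] using hT1)
    refine ⟨h1, ?_⟩
    beta_reduce
    rw [h2, hψ 0, norm_zero, radialProfile, if_pos zero_le_one, evenSeries_zero, ← hv]
    rw [← Complex.ofReal_mul, ← Complex.ofReal_mul, ← Complex.ofReal_add, ← Complex.ofReal_mul,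
      Complex.ofReal_inj]
    linear_combination -inner
  have hX : 0 < ‖x‖ := norm_pos_iff.2 hx
  obtain ⟨j, hj⟩ : ∃ j : ℤ, ‖x‖ = (p : ℝ) ^ j := ⟨_, Padic.norm_eq_zpow_neg_valuation hx⟩
  by_cases hX1 : ‖x‖ ≤ 1
  · obtain ⟨l, rfl⟩ : ∃ l : ℕ, j = -l := by
      rw [hj, zpow_le_one_iff_right₀ hp1] at hX1
      exact ⟨j.natAbs, by lia⟩
    have hxl : ‖x‖ = v ^ l := by rw [hj, zpow_neg, zpow_natCast, hv, inv_pow]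
    have hS := hasSum_lowSeries hv0 hv1 sa hX.le one_pos (mul_le_one₀ hX1 hv0.le hv1.le)
    have hT := hasSum_outward_of_inside (e := e) (c := lowSeries v e 1 -
      a 0 * (v ^ 2 / (1 - v ^ 2)) + highSeries v a 1) hv0 hv1 ha1 sa (by
        convert hT1 using 1; ring) l
    rw [← hxl] at hT
    obtain ⟨h1, h2⟩ := padicDeriv_two_radial p hψ hx
      (hS.congr_fun fun l => by
        rw [radialProfile, if_pos (mul_le_one₀ (by exact hX1) (by positivity)
          (by rw [← hv]; exact pow_le_one₀ hv0.le hv1.le)), ← hv])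
      (by rw [hvp]; exact hT)
    refine ⟨h1, ?_⟩
    have hD := evenSeries_derivative hv0 hv1 ha1 sa hX hX1
    simp_rw [ra] at hD
    have s1 := summable_evenSeries sa hX.le hX1
    have g1 : evenSeries a ‖x‖ = a 0 + ∑' n, a (n + 1) * ‖x‖ ^ (2 * n + 2) := by
      rw [evenSeries, ← s1.sum_add_tsum_nat_add 1]
      simp [mul_add]
    have s2 : Summable fun n => a (n + 1) * ‖x‖ ^ (2 * n + 2) :=
      ((summable_nat_add_iff 1).2 s1).congr fun n => by ring
    -- The recursion reproduces Eψ + ‖x‖²ψ except for the constant E a₀; the condition `inner`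
    -- supplies exactly that constant.
    have g2 : ∑' n, (E * a (n + 1) + a n) * ‖x‖ ^ (2 * n + 2) =
        E * (evenSeries a ‖x‖ - a 0) + ‖x‖ ^ 2 * evenSeries a ‖x‖ := by
      rw [← eq_sub_of_add_eq' g1.symm, evenSeries, ← tsum_mul_left, ← tsum_mul_left,
        ← (s2.mul_left E).tsum_add (s1.mul_left _)]
      congr 1
      funext n
      ring
    rw [g2, ← hK, ← hγ] at hD
    beta_reduce
    rw [h2, hψ x, radialProfile, if_pos hX1]
    rw [← Complex.ofReal_mul, ← Complex.ofReal_mul, ← Complex.ofReal_add, ← Complex.ofReal_mul,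
      Complex.ofReal_inj]
    linear_combination hD - inner
  · obtain ⟨l, rfl⟩ : ∃ l : ℕ, j = ((l + 1 : ℕ) : ℤ) := by
      rw [hj, not_le, one_lt_zpow_iff_right₀ hp1] at hX1
      exact ⟨(j - 1).natAbs, by lia⟩
    have hxl : ‖x‖ = (v ^ (l + 1))⁻¹ := by rw [hj, zpow_natCast, hvp, inv_pow]
    -- With Y = 1/‖x‖ and ψ = F(Y)/Y, inversion interchanges inward and outward sums, so D²ψ is Y³
    -- times the expression already computed for F at Y, plus the boundary term.
    obtain ⟨Y, hY⟩ : ∃ Y, Y = v ^ (l + 1) := ⟨_, rfl⟩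
    have hY0 : 0 < Y := hY ▸ pow_pos hv0 _
    have hYv : Y ≤ v := hY ▸ pow_le_of_le_one hv0.le hv1.le (by lia)
    rw [← hY] at hxl
    have hS := hasSum_inward_of_outside (a := a) (d := lowSeries v a p + highSeries v e v)
      hv0 hv1 he0 he1 se (by convert hSp using 1; ring) l
    have hT := hasSum_lowSeries hv0 hv1 se hY0.le hv0
      ((mul_le_of_le_one_right hY0.le hv1.le).trans hYv)
    rw [← hY, ← hxl] at hS
    obtain ⟨h1, h2⟩ := padicDeriv_two_radial p hψ hx
      (by rw [← hv]; exact hS)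
      (hT.congr_fun fun l => by
        have h3 : ‖x‖ * (p : ℝ) ^ (l + 1) = (Y * v ^ (l + 1))⁻¹ := by
          rw [hxl, hvp, mul_inv, inv_pow]
        have h4 : Y * v ^ (l + 1) < 1 :=
          mul_lt_one_of_nonneg_of_lt_one_left hY0.le (hYv.trans_lt hv1) (pow_le_one₀ hv0.le hv1.le)
        rw [h3, radialProfile, if_neg (not_le.2 ((one_lt_inv₀ (by positivity)).2 h4)), inv_inv]
        field_simp)
    refine ⟨h1, ?_⟩
    have hD := evenSeries_derivative hv0 hv1 he1 se hY0 hYv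
    simp_rw [re] at hD
    have s1 := summable_evenSeries se hY0.le hYv
    have s3 : Summable fun n => e (n + 3) * Y ^ (2 * n + 2) := by
      simpa using se.mul_evenSeries (q := fun _ => 1) (C := 1) 3 2 hY0.le hv0 hYv (by simp)
    have s4 : Summable fun n => e (n + 4) * Y ^ (2 * n + 2) := by
      simpa using se.mul_evenSeries (q := fun _ => 1) (C := 1) 4 2 hY0.le hv0 hYv (by simp)
    have g3 : evenSeries e Y = Y ^ 4 * ∑' n, e (n + 3) * Y ^ (2 * n + 2) := by
      rw [evenSeries, ← s1.sum_add_tsum_nat_add 3, ← tsum_mul_left]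
      simp only [Finset.sum_range_succ, Finset.sum_range_zero, he0, he1, he2]
      simp only [zero_mul, zero_add]
      congr 1
      funext n
      ring
    -- The term `e 3` is split off because ‖x‖²ψ turns it into e₃‖x‖⁻³, which no recursion cancels;
    -- `outer` balances it against the boundary term.
    have g4 : evenSeries e Y = e 3 * Y ^ 6 + Y ^ 6 * ∑' n, e (n + 4) * Y ^ (2 * n + 2) := by
      rw [evenSeries, ← s1.sum_add_tsum_nat_add 4, ← tsum_mul_left]
      simp only [Finset.sum_range_succ, Finset.sum_range_zero, he0, he1, he2]
      simp only [zero_mul, zero_add]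
      congr 1
      congr 1
      funext n
      ring
    have g5 : ∑' n, (e (n + 4) + E * e (n + 3)) * Y ^ (2 * n + 2) =
        (evenSeries e Y / Y ^ 6 - e 3) + E * (evenSeries e Y / Y ^ 4) := by
      have h3 : evenSeries e Y / Y ^ 4 = ∑' n, e (n + 3) * Y ^ (2 * n + 2) := by
        rw [g3]; field_simp
      have h4 : evenSeries e Y / Y ^ 6 - e 3 = ∑' n, e (n + 4) * Y ^ (2 * n + 2) := by
        rw [g4]; field_simp; ring
      rw [h3, h4, ← tsum_mul_left, ← s4.tsum_add (s3.mul_left E)]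
      congr 1
      funext n
      ring
    rw [g5, ← hK, ← hγ, he0] at hD
    have hΦ : ψ x = evenSeries e Y / Y := by
      rw [hψ x, radialProfile, if_neg hX1, hxl, inv_inv]; ring
    have hΦ' : radialProfile a e ‖x‖ = evenSeries e Y / Y := by rw [← hψ, hΦ]
    beta_reduce
    rw [h2, hΦ, hΦ', hxl]
    rw [← Complex.ofReal_mul, ← Complex.ofReal_mul, ← Complex.ofReal_add, ← Complex.ofReal_mul,
      Complex.ofReal_inj]
    have hD' := congrArg (· * Y ^ 3) hD
    have ho' := congrArg (· * Y ^ 3) outer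
    rw [show padicDerivConst p * (padicDerivDiag p * (evenSeries e Y / Y) / Y⁻¹ ^ 2 -
      (lowSeries v a p + highSeries v e v - highSeries v e Y) / Y⁻¹ ^ 3 - lowSeries v e Y) =
      padicDerivConst p * (padicDerivDiag p * evenSeries e Y / Y ^ 2 - lowSeries v e Y / Y ^ 3 -
        (0 * (v ^ 2 / (1 - v ^ 2)) / Y ^ 2 - highSeries v e Y)) * Y ^ 3 -
      padicDerivConst p * (lowSeries v a p + highSeries v e v) * Y ^ 3 by field_simp; ring,
      hD', ho']
    field_simp
    ring

/-! ### Rescaled recursions and their growth. -/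

/-- Numerator minus denominator is v^(2n+2) (1 − v²)(1 − v), which is positive and at most v² times
the denominator. -/
lemma gammaCorrection_mem {v : ℝ} (hv0 : 0 < v) (hv1 : v < 1) (n : ℕ) :
    1 ≤ gammaCorrection v n ∧ gammaCorrection v n ≤ 1 + v ^ 2 := by
  have h2 := one_sub_pow_pos hv0 hv1 (n := 2 * n + 2) (by lia)
  have h5 := one_sub_pow_pos hv0 hv1 (n := 2 * n + 5) (by lia)
  have hu0 : 0 < v ^ (2 * n + 2) := by positivity
  have hu : v ^ (2 * n + 2) ≤ v ^ 2 := pow_le_pow_of_le_one hv0.le hv1.le (by lia)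
  have hu5 : v ^ (2 * n + 5) ≤ v := pow_le_of_le_one hv0.le hv1.le (by lia)
  have hD : 0 < (1 - v ^ (2 * n + 2)) * (1 - v ^ (2 * n + 5)) := mul_pos h2 h5
  have key : (1 - v ^ (2 * n + 4)) * (1 - v ^ (2 * n + 3)) =
      (1 - v ^ (2 * n + 2)) * (1 - v ^ (2 * n + 5)) +
        v ^ (2 * n + 2) * ((1 - v ^ 2) * (1 - v)) := by ring
  have h2' : 0 < 1 - v ^ 2 := one_sub_pow_pos hv0 hv1 two_ne_zero
  have hm : (1 - v ^ 2) * (1 - v) ≤ (1 - v ^ (2 * n + 2)) * (1 - v ^ (2 * n + 5)) :=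
    mul_le_mul (by linarith) (by linarith) (by linarith) h2.le
  rw [gammaCorrection, key, le_div_iff₀ hD, div_le_iff₀ hD]
  constructor
  · have : 0 < v ^ (2 * n + 2) * ((1 - v ^ 2) * (1 - v)) :=
      mul_pos hu0 (mul_pos h2' (by linarith))
    linarith
  · have : v ^ (2 * n + 2) * ((1 - v ^ 2) * (1 - v)) ≤
        v ^ 2 * ((1 - v ^ (2 * n + 2)) * (1 - v ^ (2 * n + 5))) :=
      mul_le_mul hu hm (mul_pos h2' (by linarith)).le (by positivity)
    linarith

/-- The normalized coefficients of the inner series. -/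
def innerSeq (v E : ℝ) : ℕ → ℝ
  | 0 => 1
  | 1 => 0
  | n + 2 => (innerSeq v E n + v * E * innerSeq v E (n + 1)) / gammaCorrection v n

/-- The normalized coefficients of the outer series. -/
def outerSeq (v E : ℝ) : ℕ → ℝ
  | 0 => 0
  | 1 => 1
  | n + 2 => gammaCorrection v n * outerSeq v E n - v * E * outerSeq v E (n + 1)

section

variable {v E : ℝ}

/-- Dividing by w_n ≥ 1 does not increase absolute values, and |vE| ≤ 1, so 2ⁿ + 2ⁿ⁺¹ ≤ 2ⁿ⁺² closes
the induction. -/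
lemma abs_innerSeq_le (hv0 : 0 < v) (hv1 : v < 1) (hE : |E| ≤ 1) (n : ℕ) :
    |innerSeq v E n| ≤ 2 ^ n := by
  induction n using Nat.twoStepInduction with
  | zero => simp [innerSeq]
  | one => simp [innerSeq]
  | more n h0 h1 =>
    have hw := (gammaCorrection_mem hv0 hv1 n).1
    rw [innerSeq, abs_div, abs_of_pos (by linarith : 0 < gammaCorrection v n)]
    have hvE : |v * E| ≤ 1 := by
      rw [abs_mul, abs_of_pos hv0]; exact mul_le_one₀ hv1.le (abs_nonneg _) hE
    calc _ ≤ |innerSeq v E n + v * E * innerSeq v E (n + 1)| := div_le_self (abs_nonneg _) hw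
      _ ≤ |innerSeq v E n| + |v * E * innerSeq v E (n + 1)| := abs_add_le _ _
      _ ≤ 2 ^ n + 1 * 2 ^ (n + 1) := by rw [abs_mul (v * E)]; gcongr
      _ ≤ 2 ^ (n + 2) := by ring_nf; nlinarith [pow_pos (two_pos : (0 : ℝ) < 2) n]

lemma abs_outerSeq_le (hv0 : 0 < v) (hv1 : v < 1) (hE : |E| ≤ 1) (n : ℕ) :
    |outerSeq v E n| ≤ 2 ^ n := by
  induction n using Nat.twoStepInduction with
  | zero => simp [outerSeq]
  | one => simp [outerSeq]
  | more n h0 h1 =>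
    have hw := gammaCorrection_mem hv0 hv1 n
    have hw2 : |gammaCorrection v n| ≤ 2 := by
      rw [abs_of_pos (by linarith)]; nlinarith
    have hvE : |v * E| ≤ 1 := by
      rw [abs_mul, abs_of_pos hv0]; exact mul_le_one₀ hv1.le (abs_nonneg _) hE
    rw [outerSeq]
    calc _ ≤ |gammaCorrection v n * outerSeq v E n| + |v * E * outerSeq v E (n + 1)| :=
          abs_sub _ _
      _ ≤ 2 * 2 ^ n + 1 * 2 ^ (n + 1) := by rw [abs_mul (v * E), abs_mul]; gcongr
      _ = 2 ^ (n + 2) := by ring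

lemma continuous_innerSeq (v : ℝ) (n : ℕ) : Continuous fun E => innerSeq v E n := by
  induction n using Nat.twoStepInduction with
  | zero => simpa [innerSeq] using continuous_const
  | one => simpa [innerSeq] using continuous_const
  | more n h0 h1 => simp only [innerSeq]; fun_prop

lemma continuous_outerSeq (v : ℝ) (n : ℕ) : Continuous fun E => outerSeq v E n := by
  induction n using Nat.twoStepInduction with
  | zero => simpa [outerSeq] using continuous_const
  | one => simpa [outerSeq] using continuous_const
  | more n h0 h1 => simp only [outerSeq]; fun_prop

end

/-- Comparison with a geometric series of ratio 2v ≤ 1/2. The factor 4 is the weight bound 2 times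
the geometric sum, at most 2. -/
lemma summable_of_abs_le_two_pow {v : ℝ} (hv0 : 0 < v) (hv : v ≤ 1 / 4) {u q : ℕ → ℝ}
    (hu : ∀ n, |u n| ≤ 2 ^ n) (hq : ∀ n, |q n| ≤ 2) (k : ℕ) :
    (Summable fun n => u (n + k) * v ^ (n + k) * q n) ∧
      |∑' n, u (n + k) * v ^ (n + k) * q n| ≤ 4 * (2 * v) ^ k := by
  have hb (n : ℕ) : ‖u (n + k) * v ^ (n + k) * q n‖ ≤ 2 * (2 * v) ^ k * (2 * v) ^ n := by
    rw [Real.norm_eq_abs, abs_mul, abs_mul, abs_of_pos (pow_pos hv0 _)]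
    calc _ ≤ 2 ^ (n + k) * v ^ (n + k) * 2 := by
          gcongr
          exacts [hu _, hq _]
      _ = _ := by rw [mul_pow, mul_pow]; ring
  have hg := (hasSum_geometric_of_lt_one (r := 2 * v) (by linarith) (by linarith)).mul_left
    (2 * (2 * v) ^ k)
  refine ⟨hg.summable.of_norm_bounded hb, (tsum_of_norm_bounded hg hb).trans ?_⟩
  have : (1 - 2 * v)⁻¹ ≤ 2 := inv_le_of_inv_le₀ two_pos (by linarith)
  have h0 : 0 ≤ 2 * (2 * v) ^ k := by positivity
  nlinarith

lemma continuousOn_tsum_of_abs_le_two_pow {v : ℝ} (hv0 : 0 < v) (hv : v ≤ 1 / 4)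
    {u : ℝ → ℕ → ℝ} {q : ℕ → ℝ} {s : Set ℝ} (hc : ∀ n, Continuous fun E => u E n)
    (hu : ∀ E ∈ s, ∀ n, |u E n| ≤ 2 ^ n) (hq : ∀ n, |q n| ≤ 2) (k : ℕ) :
    ContinuousOn (fun E => ∑' n, u E (n + k) * v ^ (n + k) * q n) s := by
  refine continuousOn_tsum (u := fun n => 2 * (2 * v) ^ k * (2 * v) ^ n)
    (fun n => (((hc (n + k)).mul_const _).mul_const _).continuousOn)
    ((summable_geometric_of_lt_one (by linarith) (by linarith)).mul_left _) fun n E hE => ?_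
  rw [Real.norm_eq_abs, abs_mul, abs_mul, abs_of_pos (pow_pos hv0 _)]
  calc _ ≤ 2 ^ (n + k) * v ^ (n + k) * 2 := by
        gcongr
        exacts [hu E hE _, hq _]
    _ = _ := by rw [mul_pow, mul_pow]; ring

lemma abs_div_one_sub_pow_le {v x : ℝ} (hv0 : 0 < v) (hv : v ≤ 1 / 4) (hx : |x| ≤ 1) {m : ℕ}
    (hm : m ≠ 0) : |x / (1 - v ^ m)| ≤ 2 := by
  have h : v ^ m ≤ v := pow_le_of_le_one hv0.le (by linarith) hm
  rw [abs_div, abs_of_pos (by linarith : 0 < 1 - v ^ m), div_le_iff₀ (by linarith)]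
  linarith

/-! ### Estimates for the matching conditions and their solution. -/

section

variable (v E : ℝ)

/-- The contribution of the inner series to the integral over the unit ball. -/
def innerMass : ℝ := ∑' n, innerSeq v E (n + 0) * v ^ (n + 0) * (1 / (1 - v ^ (2 * n + 1)))

/-- The contribution of the inner series to the constant term of the equation. -/
def innerTail : ℝ := ∑' n, innerSeq v E (n + 2) * v ^ (n + 2) * (1 / (1 - v ^ (2 * n + 2)))

/-- The contribution of the normalized outer series to the coefficient of `|x|⁻³`. -/
def outerMass : ℝ :=
  ∑' n, outerSeq v E (n + 1) * v ^ (n + 1) * (v ^ 2 / (1 - v ^ (2 * (n + 1) + 2)))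

/-- The contribution of the normalized outer series to the constant term of the equation. -/
def outerTail : ℝ :=
  ∑' n, outerSeq v E (n + 1) * v ^ (n + 1) * (v ^ 5 / (1 - v ^ (2 * (n + 1) + 5)))

end

section

variable {v E : ℝ}

lemma abs_pow_le_one {v : ℝ} (hv0 : 0 < v) (hv : v ≤ 1 / 4) (m : ℕ) : |v ^ m| ≤ 1 := by
  rw [abs_of_pos (pow_pos hv0 _)]; exact pow_le_one₀ hv0.le (by linarith)

lemma tsum_mul_const_weight {u q : ℕ → ℝ} (c : ℝ) :
    ∑' n, u n * (c * q n) = c * ∑' n, u n * q n := by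
  rw [← tsum_mul_left]
  congr 1
  funext n
  ring

lemma abs_innerMass_le (hv0 : 0 < v) (hv : v ≤ 1 / 100) (hE : |E| ≤ 1) : |innerMass v E| ≤ 4 := by
  refine (summable_of_abs_le_two_pow hv0 (by linarith)
    (abs_innerSeq_le hv0 (by linarith) hE) (q := fun n => 1 / (1 - v ^ (2 * n + 1)))
    (fun n => abs_div_one_sub_pow_le hv0 (by linarith) (by simp) (by lia)) 0).2.trans ?_
  norm_num

/-- The first term is at least 1 and the remainder at most 8v. Positivity makes κ, and hence k_5,
nonzero. -/
lemma innerMass_pos (hv0 : 0 < v) (hv : v ≤ 1 / 100) (hE : |E| ≤ 1) : 0 < innerMass v E := by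
  have hu := abs_innerSeq_le hv0 (by linarith : v < 1) hE
  have h0 := summable_of_abs_le_two_pow hv0 (by linarith) hu
    (q := fun n => 1 / (1 - v ^ (2 * n + 1)))
    (fun n => abs_div_one_sub_pow_le hv0 (by linarith) (by simp) (by lia)) 0
  have h1 := (summable_of_abs_le_two_pow hv0 (by linarith) hu
    (q := fun n => 1 / (1 - v ^ (2 * (n + 1) + 1)))
    (fun n => abs_div_one_sub_pow_le hv0 (by linarith) (by simp) (by lia)) 1).2
  rw [innerMass, ← h0.1.sum_add_tsum_nat_add 1]
  simp only [Finset.sum_range_one, add_zero, innerSeq, pow_zero, mul_zero, zero_add, pow_one,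
    one_mul] at h1 ⊢
  have h3 : 1 ≤ 1 / (1 - v) := by rw [le_div_iff₀] <;> linarith
  linarith [(abs_le.1 h1).1]

lemma abs_outerMass_le (hv0 : 0 < v) (hv : v ≤ 1 / 100) (hE : |E| ≤ 1) :
    |outerMass v E| ≤ 8 * v ^ 3 := by
  have h := (summable_of_abs_le_two_pow hv0 (by linarith)
    (abs_outerSeq_le hv0 (by linarith) hE) (q := fun n => 1 / (1 - v ^ (2 * (n + 1) + 2)))
    (fun n => abs_div_one_sub_pow_le hv0 (by linarith) (by simp) (by lia)) 1).2
  have h1 : outerMass v E = v ^ 2 * ∑' n, outerSeq v E (n + 1) * v ^ (n + 1) *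
      (1 / (1 - v ^ (2 * (n + 1) + 2))) := by
    rw [← tsum_mul_const_weight, outerMass]
    simp only [mul_one_div]
  rw [h1, abs_mul, abs_of_pos (by positivity)]
  nlinarith [pow_pos hv0 2]

lemma abs_outerTail_le (hv0 : 0 < v) (hv : v ≤ 1 / 100) (hE : |E| ≤ 1) :
    |outerTail v E| ≤ 8 * v ^ 6 := by
  have h := (summable_of_abs_le_two_pow hv0 (by linarith)
    (abs_outerSeq_le hv0 (by linarith) hE) (q := fun n => 1 / (1 - v ^ (2 * (n + 1) + 5)))
    (fun n => abs_div_one_sub_pow_le hv0 (by linarith) (by simp) (by lia)) 1).2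
  have h1 : outerTail v E = v ^ 5 * ∑' n, outerSeq v E (n + 1) * v ^ (n + 1) *
      (1 / (1 - v ^ (2 * (n + 1) + 5))) := by
    rw [← tsum_mul_const_weight, outerTail]
    simp only [mul_one_div]
  rw [h1, abs_mul, abs_of_pos (by positivity)]
  nlinarith [pow_pos hv0 5]

/-- The cancellation behind E = O(v²): u_2 = 1/w_0 is within v² of 1, so the leading term v²/(1 −
v²) drops out. The constant is 2 from u_2, 2 from u_3 and 64 from the remaining terms. -/
lemma abs_innerTail_sub_le (hv0 : 0 < v) (hv : v ≤ 1 / 100) (hE : |E| ≤ 1) :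
    |innerTail v E - v ^ 2 / (1 - v ^ 2)| ≤ 68 * v ^ 4 := by
  have hv1 : v < 1 := by linarith
  have hu := abs_innerSeq_le hv0 hv1 hE
  have h0 := summable_of_abs_le_two_pow hv0 (by linarith) hu
    (q := fun n => 1 / (1 - v ^ (2 * n + 2)))
    (fun n => abs_div_one_sub_pow_le hv0 (by linarith) (by simp) (by lia)) 2
  have h1 := (summable_of_abs_le_two_pow hv0 (by linarith) hu
    (q := fun n => 1 / (1 - v ^ (2 * (n + 2) + 2)))
    (fun n => abs_div_one_sub_pow_le hv0 (by linarith) (by simp) (by lia)) 4).2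
  rw [innerTail, ← h0.1.sum_add_tsum_nat_add 2]
  simp only [Finset.sum_range_succ, Finset.sum_range_zero, zero_add, mul_zero, mul_one,
    Nat.reduceAdd, add_assoc] at h1 ⊢
  obtain ⟨w0, w0'⟩ := gammaCorrection_mem hv0 hv1 0
  obtain ⟨w1, -⟩ := gammaCorrection_mem hv0 hv1 1
  have e2 : innerSeq v E 2 = 1 / gammaCorrection v 0 := by simp [innerSeq]
  have e3 : innerSeq v E 3 = v * E * innerSeq v E 2 / gammaCorrection v 1 := by simp [innerSeq]
  have b2 : |innerSeq v E 2 - 1| ≤ v ^ 2 := by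
    rw [e2, abs_sub_comm, abs_of_nonneg, sub_le_iff_le_add, ← sub_le_iff_le_add', le_div_iff₀]
    · nlinarith
    · linarith
    · rw [sub_nonneg, div_le_one] <;> linarith
  have b2' : |innerSeq v E 2| ≤ 1 := by
    rw [e2, abs_of_pos (by positivity), div_le_one] <;> linarith
  have b3 : |innerSeq v E 3| ≤ v := by
    rw [e3, abs_div, abs_of_pos (by linarith : 0 < gammaCorrection v 1)]
    refine (div_le_self (abs_nonneg _) w1).trans ?_
    rw [abs_mul, abs_mul, abs_of_pos hv0]
    calc v * |E| * |innerSeq v E 2| ≤ v * 1 * 1 := by gcongr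
      _ = v := by ring
  have t2 : |innerSeq v E 2 * v ^ 2 * (1 / (1 - v ^ 2)) - v ^ 2 / (1 - v ^ 2)| ≤ 2 * v ^ 4 := by
    rw [show innerSeq v E 2 * v ^ 2 * (1 / (1 - v ^ 2)) - v ^ 2 / (1 - v ^ 2) =
      (innerSeq v E 2 - 1) * v ^ 2 * (1 / (1 - v ^ 2)) by ring, abs_mul, abs_mul,
      abs_of_pos (pow_pos hv0 2)]
    calc _ ≤ v ^ 2 * v ^ 2 * 2 := by
          gcongr
          exact abs_div_one_sub_pow_le hv0 (by linarith) (by simp) (by lia)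
      _ = _ := by ring
  have t3 : |innerSeq v E 3 * v ^ 3 * (1 / (1 - v ^ 4))| ≤ 2 * v ^ 4 := by
    rw [abs_mul, abs_mul, abs_of_pos (pow_pos hv0 3)]
    calc _ ≤ v * v ^ 3 * 2 := by
          gcongr
          exact abs_div_one_sub_pow_le hv0 (by linarith) (by simp) (by lia)
      _ = _ := by ring
  rw [add_sub_right_comm]
  refine (abs_add_le _ _).trans ?_
  have h4 : 4 * (2 * v) ^ 4 = 64 * v ^ 4 := by ring
  have := abs_add_le (innerSeq v E 3 * v ^ 3 * (1 / (1 - v ^ 4)))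
    (∑' n, innerSeq v E (n + 4) * v ^ (n + 4) * (1 / (1 - v ^ (2 * (n + 2) + 2))))
  linarith

end

section

variable {v : ℝ}

lemma derivConst_pos_le (hv0 : 0 < v) (hv1 : v < 1) :
    0 < (v⁻¹ ^ 2 - 1) / (1 - v ^ 3) * (1 - v) ∧
      (v⁻¹ ^ 2 - 1) / (1 - v ^ 3) * (1 - v) * v ^ 2 ≤ 1 := by
  have h2 := one_sub_pow_pos hv0 hv1 (n := 2) (by lia)
  have h3 := one_sub_pow_pos hv0 hv1 (n := 3) (by lia)
  have h1 : 0 < 1 - v := by linarith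
  have hv3 : v ^ 3 ≤ v := pow_le_of_le_one hv0.le hv1.le (by lia)
  have e : (v⁻¹ ^ 2 - 1) / (1 - v ^ 3) * (1 - v) = (1 - v ^ 2) * (1 - v) / (1 - v ^ 3) / v ^ 2 := by
    field_simp
  rw [e]
  refine ⟨by positivity, ?_⟩
  rw [div_mul_cancel₀ _ (by positivity), div_le_one h3]
  nlinarith [pow_pos hv0 2]

/-- The energy and the ratio of the outer to the inner coefficients can be chosen so that both
matching conditions hold; the energy is of order `v²`. -/
lemma exists_matching (hv0 : 0 < v) (hv : v ≤ 1 / 100) :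
    ∃ E κ : ℝ, |E| ≤ 100 * v ^ 2 ∧ κ ≠ 0 ∧
      (v⁻¹ ^ 2 - 1) / (1 - v ^ 3) * (1 - v) *
        (κ * outerTail v E - v ^ 2 / (1 - v ^ 2) + innerTail v E) = -E ∧
      (v⁻¹ ^ 2 - 1) / (1 - v ^ 3) * (1 - v) * (innerMass v E + κ * outerMass v E) =
        -(κ * v⁻¹) := by
  have hv1 : v < 1 := by linarith
  obtain ⟨hK0, hK1⟩ := derivConst_pos_le hv0 hv1
  generalize (v⁻¹ ^ 2 - 1) / (1 - v ^ 3) * (1 - v) = K at hK0 hK1 ⊢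
  have hmem {E : ℝ} (hE : E ∈ Set.Icc (-1 : ℝ) 1) : |E| ≤ 1 := abs_le.2 hE
  have hq (m : ℕ → ℕ) (x : ℝ) (hx : |x| ≤ 1) (hm : ∀ n, m n ≠ 0) (n : ℕ) :
      |x / (1 - v ^ m n)| ≤ 2 := abs_div_one_sub_pow_le hv0 (by linarith) hx (hm n)
  have hpow (m : ℕ) : |v ^ m| ≤ 1 := abs_pow_le_one hv0 (by linarith) m
  have ca : ContinuousOn (innerMass v) (Set.Icc (-1) 1) :=
    continuousOn_tsum_of_abs_le_two_pow hv0 (by linarith) (continuous_innerSeq v)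
      (fun E hE => abs_innerSeq_le hv0 hv1 (hmem hE)) (hq _ 1 (by simp) fun n => by lia) 0
  have ch : ContinuousOn (innerTail v) (Set.Icc (-1) 1) :=
    continuousOn_tsum_of_abs_le_two_pow hv0 (by linarith) (continuous_innerSeq v)
      (fun E hE => abs_innerSeq_le hv0 hv1 (hmem hE)) (hq _ 1 (by simp) fun n => by lia) 2
  have cb : ContinuousOn (outerMass v) (Set.Icc (-1) 1) :=
    continuousOn_tsum_of_abs_le_two_pow hv0 (by linarith) (continuous_outerSeq v)
      (fun E hE => abs_outerSeq_le hv0 hv1 (hmem hE)) (hq _ (v ^ 2) (hpow 2) fun n => by lia) 1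
  have cc : ContinuousOn (outerTail v) (Set.Icc (-1) 1) :=
    continuousOn_tsum_of_abs_le_two_pow hv0 (by linarith) (continuous_outerSeq v)
      (fun E hE => abs_outerSeq_le hv0 hv1 (hmem hE)) (hq _ (v ^ 5) (hpow 5) fun n => by lia) 1
  -- Since K ≤ v⁻² and the outer mass is at most 8v³, the term K · `outerMass` is a small
  -- perturbation of v⁻¹, so the linear equation for κ is solvable for every |E| ≤ 1.
  have hD {E : ℝ} (hE : |E| ≤ 1) : 1 / 2 ≤ (v⁻¹ + K * outerMass v E) * v := by
    have h1 : |K * outerMass v E * v| ≤ 8 * v ^ 2 := by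
      rw [abs_mul, abs_mul, abs_of_pos hv0, abs_of_pos hK0]
      calc K * |outerMass v E| * v ≤ K * (8 * v ^ 3) * v := by
            gcongr
            exact abs_outerMass_le hv0 hv hE
        _ = 8 * v ^ 2 * (K * v ^ 2) := by ring
        _ ≤ _ := mul_le_of_le_one_right (by positivity) hK1
    rw [add_mul, inv_mul_cancel₀ hv0.ne']
    nlinarith [(abs_le.1 h1).1]
  have hDpos {E : ℝ} (hE : |E| ≤ 1) : 0 < v⁻¹ + K * outerMass v E :=
    pos_of_mul_pos_left ((by norm_num : (0 : ℝ) < 1 / 2).trans_le (hD hE)) hv0.le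
  set κ : ℝ → ℝ := fun E => -(K * innerMass v E) / (v⁻¹ + K * outerMass v E) with hκ
  have cκ : ContinuousOn κ (Set.Icc (-1) 1) :=
    (ca.const_smul K).neg.div (continuousOn_const.add (cb.const_smul K))
      fun E hE => (hDpos (hmem hE)).ne'
  have bκ {E : ℝ} (hE : |E| ≤ 1) : |κ E| * v ^ 3 ≤ 8 * v ^ 2 := by
    have hDp := hDpos hE
    rw [hκ]
    simp only
    rw [abs_div, abs_neg, abs_mul, abs_of_pos hK0, abs_of_pos hDp, div_mul_eq_mul_div,
      div_le_iff₀ hDp]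
    have h1 := abs_innerMass_le hv0 hv hE
    have h2 := hD hE
    calc K * |innerMass v E| * v ^ 3 = K * v ^ 2 * |innerMass v E| * v := by ring
      _ ≤ 1 * 4 * v := by gcongr
      _ ≤ 8 * v * ((v⁻¹ + K * outerMass v E) * v) := by nlinarith
      _ = _ := by ring
  set R : ℝ → ℝ := fun E => K * (κ E * outerTail v E - v ^ 2 / (1 - v ^ 2) + innerTail v E)
    with hR
  have bR {E : ℝ} (hE : |E| ≤ 1) : |R E| ≤ 100 * v ^ 2 := by
    have h1 : |κ E * outerTail v E| ≤ v ^ 4 := by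
      rw [abs_mul]
      calc _ ≤ |κ E| * (8 * v ^ 6) := by
            gcongr
            exact abs_outerTail_le hv0 hv hE
        _ = 8 * v ^ 3 * (|κ E| * v ^ 3) := by ring
        _ ≤ 8 * v ^ 3 * (8 * v ^ 2) := mul_le_mul_of_nonneg_left (bκ hE) (by positivity)
        _ = 64 * v * v ^ 4 := by ring
        _ ≤ 1 * v ^ 4 := by gcongr; linarith
        _ = v ^ 4 := one_mul _
    have h2 := abs_innerTail_sub_le hv0 hv hE
    have h3 : |κ E * outerTail v E - v ^ 2 / (1 - v ^ 2) + innerTail v E| ≤ 100 * v ^ 4 := by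
      have := abs_add_le (κ E * outerTail v E) (innerTail v E - v ^ 2 / (1 - v ^ 2))
      rw [show κ E * outerTail v E - v ^ 2 / (1 - v ^ 2) + innerTail v E =
        κ E * outerTail v E + (innerTail v E - v ^ 2 / (1 - v ^ 2)) by ring]
      linarith [pow_pos hv0 4]
    rw [hR]
    simp only
    rw [abs_mul, abs_of_pos hK0]
    calc _ ≤ K * (100 * v ^ 4) := by gcongr
      _ = 100 * v ^ 2 * (K * v ^ 2) := by ring
      _ ≤ _ := mul_le_of_le_one_right (by positivity) hK1
  have cF : ContinuousOn (fun E => E + R E) (Set.Icc (-1) 1) :=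
    continuousOn_id.add ((((cκ.mul cc).sub continuousOn_const).add ch).const_smul K)
  have hsmall : 100 * v ^ 2 ≤ 1 := by nlinarith
  -- As |R| ≤ 100 v² ≤ 1, the function E + R(E) changes sign on [-1, 1]. At the root E = −R(E),
  -- which inherits the bound on R.
  obtain ⟨E, hE, hE0⟩ := intermediate_value_Icc (by norm_num) cF
    (⟨by linarith [(abs_le.1 (bR (E := -1) (by simp))).2],
      by linarith [(abs_le.1 (bR (E := 1) (by simp))).1]⟩ : (0 : ℝ) ∈ Set.Icc _ _)
  simp only at hE0
  have hE' := hmem hE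
  refine ⟨E, κ E, ?_, ?_, ?_, ?_⟩
  · rw [eq_neg_of_add_eq_zero_left hE0, abs_neg]
    exact bR hE'
  · exact div_ne_zero (neg_ne_zero.2 (mul_pos hK0 (innerMass_pos hv0 hv hE')).ne') (hDpos hE').ne'
  · exact eq_neg_of_add_eq_zero_right hE0
  · have h1 : κ E * (v⁻¹ + K * outerMass v E) = -(K * innerMass v E) :=
      div_mul_cancel₀ _ (hDpos hE').ne'
    linear_combination h1

end

/-! ### Asymptotics of the rescaled sequences. -/

/-- Each division by w costs O(v²), and the parities interact only through vE = O(v³). The constant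
may grow with n but is uniform in v and E, so E may vary with p. -/
lemma innerSeq_asymptotics {M : ℝ} (hM : 0 ≤ M) (n : ℕ) :
    ∃ C : ℝ, 0 ≤ C ∧ ∀ v E : ℝ, 0 < v → v < 1 → |E| ≤ M * v ^ 2 →
      |innerSeq v E (2 * n) - 1| ≤ C * v ^ 2 ∧ |innerSeq v E (2 * n + 1)| ≤ C * v ^ 3 := by
  induction n with
  | zero =>
    refine ⟨0, le_rfl, fun v E _ _ _ => ?_⟩
    simp [innerSeq]
  | succ n ih =>
    obtain ⟨C, hC, h⟩ := ih
    set C' := C + 1 + M * C with hC'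
    have hC'0 : 0 ≤ C' := by positivity
    refine ⟨C' + C + M * (1 + C'), by positivity, fun v E hv0 hv1 hE => ?_⟩
    obtain ⟨h0, h1⟩ := h v E hv0 hv1 hE
    have hw (m : ℕ) := gammaCorrection_mem hv0 hv1 m
    have hv2 : v ^ 2 ≤ 1 := pow_le_one₀ hv0.le hv1.le
    have hdiv (m : ℕ) (x : ℝ) : |x / gammaCorrection v m| ≤ |x| := by
      rw [abs_div, abs_of_pos (by linarith [(hw m).1] : 0 < gammaCorrection v m)]
      exact div_le_self (abs_nonneg _) (hw m).1
    have hvE : |v * E| ≤ M * v ^ 3 := by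
      rw [abs_mul, abs_of_pos hv0]
      calc v * |E| ≤ v * (M * v ^ 2) := by gcongr
        _ = _ := by ring
    have h2 : |innerSeq v E (2 * n + 2) - 1| ≤ C' * v ^ 2 := by
      have e : innerSeq v E (2 * n + 2) - 1 =
          ((innerSeq v E (2 * n) - 1) + (1 - gammaCorrection v (2 * n)) +
            v * E * innerSeq v E (2 * n + 1)) / gammaCorrection v (2 * n) := by
        have := (hw (2 * n)).1
        rw [innerSeq]
        field_simp
        ring
      rw [e]
      refine (hdiv _ _).trans ((abs_add_three _ _ _).trans ?_)
      have t1 : |1 - gammaCorrection v (2 * n)| ≤ v ^ 2 := by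
        rw [abs_le]; constructor <;> linarith [hw (2 * n), (hw (2 * n)).1, (hw (2 * n)).2]
      have t2 : |v * E * innerSeq v E (2 * n + 1)| ≤ M * C * v ^ 2 := by
        rw [abs_mul]
        calc _ ≤ M * v ^ 3 * (C * v ^ 3) := by gcongr
          _ = M * C * v ^ 2 * (v ^ 2 * v ^ 2) := by ring
          _ ≤ _ := mul_le_of_le_one_right (by positivity) (mul_le_one₀ hv2 (by positivity) hv2)
      rw [hC']
      linarith
    constructor
    · refine h2.trans ?_
      gcongr
      have : 0 ≤ M * (1 + C') := by positivity
      linarith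
    · have t0 : |innerSeq v E (2 * n + 2)| ≤ 1 + C' := by
        have := abs_add_le (innerSeq v E (2 * n + 2) - 1) 1
        rw [sub_add_cancel, abs_one] at this
        nlinarith
      rw [show 2 * (n + 1) + 1 = 2 * n + 1 + 2 by ring, innerSeq]
      refine (hdiv _ _).trans ((abs_add_le _ _).trans ?_)
      have t3 : |v * E * innerSeq v E (2 * n + 1 + 1)| ≤ M * v ^ 3 * (1 + C') := by
        rw [abs_mul]; gcongr
      have : 0 ≤ C' * v ^ 3 := by positivity
      linarith

/-- The same perturbation argument with the parities exchanged; the multiplier w ≤ 2 enlarges the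
constant at each step. -/
lemma outerSeq_asymptotics {M : ℝ} (hM : 0 ≤ M) (n : ℕ) :
    ∃ C : ℝ, 0 ≤ C ∧ ∀ v E : ℝ, 0 < v → v < 1 → |E| ≤ M * v ^ 2 →
      |outerSeq v E (2 * n)| ≤ C * v ^ 3 ∧ |outerSeq v E (2 * n + 1) - 1| ≤ C * v ^ 2 := by
  induction n with
  | zero =>
    refine ⟨0, le_rfl, fun v E _ _ _ => ?_⟩
    simp [outerSeq]
  | succ n ih =>
    obtain ⟨C, hC, h⟩ := ih
    set C' := 2 * C + M * (1 + C) with hC'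
    have hC'0 : 0 ≤ C' := by positivity
    refine ⟨C' + 2 * C + 1 + M * C', by positivity, fun v E hv0 hv1 hE => ?_⟩
    obtain ⟨h0, h1⟩ := h v E hv0 hv1 hE
    have hv2 : v ^ 2 ≤ 1 := pow_le_one₀ hv0.le hv1.le
    have hw (m : ℕ) : |gammaCorrection v m| ≤ 2 := by
      have := gammaCorrection_mem hv0 hv1 m
      rw [abs_of_pos (by linarith)]
      linarith
    have hw' (m : ℕ) : |gammaCorrection v m - 1| ≤ v ^ 2 := by
      have := gammaCorrection_mem hv0 hv1 m
      rw [abs_of_nonneg (by linarith)]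
      linarith
    have hvE : |v * E| ≤ M * v ^ 3 := by
      rw [abs_mul, abs_of_pos hv0]
      calc v * |E| ≤ v * (M * v ^ 2) := by gcongr
        _ = _ := by ring
    have h2 : |outerSeq v E (2 * n + 2)| ≤ C' * v ^ 3 := by
      rw [outerSeq]
      refine (abs_sub _ _).trans ?_
      have t0 : |outerSeq v E (2 * n + 1)| ≤ 1 + C := by
        have := abs_add_le (outerSeq v E (2 * n + 1) - 1) 1
        rw [sub_add_cancel, abs_one] at this
        nlinarith
      rw [abs_mul, abs_mul (v * E)]
      calc _ ≤ 2 * (C * v ^ 3) + M * v ^ 3 * (1 + C) := by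
            gcongr
            exact hw _
        _ = _ := by rw [hC']; ring
    constructor
    · refine h2.trans ?_
      gcongr
      have : 0 ≤ M * C' := by positivity
      linarith
    · have e : outerSeq v E (2 * n + 3) - 1 =
          gammaCorrection v (2 * n + 1) * (outerSeq v E (2 * n + 1) - 1) +
            (gammaCorrection v (2 * n + 1) - 1) + -(v * E * outerSeq v E (2 * n + 2)) := by
        rw [outerSeq]; ring
      rw [show 2 * (n + 1) + 1 = 2 * n + 3 by ring, e]
      refine (abs_add_three _ _ _).trans ?_
      rw [abs_neg, abs_mul, abs_mul (v * E)]
      have t2 : |v * E| * |outerSeq v E (2 * n + 2)| ≤ M * C' * v ^ 2 := by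
        calc _ ≤ M * v ^ 3 * (C' * v ^ 3) := by gcongr
          _ = M * C' * v ^ 2 * (v ^ 2 * v ^ 2) := by ring
          _ ≤ _ := mul_le_of_le_one_right (by positivity) (mul_le_one₀ hv2 (by positivity) hv2)
      have t1 : |gammaCorrection v (2 * n + 1)| * |outerSeq v E (2 * n + 1) - 1| ≤
          2 * (C * v ^ 2) := by
        gcongr
        exact hw _
      have t3 := hw' (2 * n + 1)
      have : 0 ≤ C' * v ^ 2 := by positivity
      linarith

/-! ### Gamma quotients and the coefficient sequences. -/

lemma padicGamma_ratio_pos {p : ℕ} (hp : 1 < p) (n : ℕ) :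
    padicGamma p (2 * n + 5) / padicGamma p (2 * n + 3) =
      (p : ℝ) ^ 2 * gammaCorrection (p : ℝ)⁻¹ n := by
  have hp1 : (1 : ℝ) < p := by exact_mod_cast hp
  have hp0 : (0 : ℝ) < p := by linarith
  have hv1 : (p : ℝ)⁻¹ < 1 := inv_lt_one_of_one_lt₀ hp1
  have hneg (m : ℕ) : (p : ℝ) ^ (-(m : ℝ)) = (p : ℝ)⁻¹ ^ m := by
    rw [Real.rpow_neg hp0.le, Real.rpow_natCast, inv_pow]
  have hpos (m : ℕ) : 1 - (p : ℝ) ^ m = -((p : ℝ) ^ m * (1 - (p : ℝ)⁻¹ ^ m)) := by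
    rw [mul_sub, ← mul_pow, mul_inv_cancel₀ hp0.ne', one_pow]; ring
  have d (m : ℕ) (hm : m ≠ 0) := (one_sub_pow_pos (inv_pos.2 hp0) hv1 hm).ne'
  rw [padicGamma, padicGamma, show (2 * n + 5 - 1 : ℝ) = ((2 * n + 4 : ℕ) : ℝ) by push_cast; ring,
    show (2 * n + 3 - 1 : ℝ) = ((2 * n + 2 : ℕ) : ℝ) by push_cast; ring,
    show (2 * n + 5 : ℝ) = ((2 * n + 5 : ℕ) : ℝ) by push_cast; ring,
    show (2 * n + 3 : ℝ) = ((2 * n + 3 : ℕ) : ℝ) by push_cast; ring,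
    Real.rpow_natCast, Real.rpow_natCast, hneg, hneg, hpos, hpos, gammaCorrection]
  have d2 := d (2 * n + 2) (by lia)
  have d3 := d (2 * n + 3) (by lia)
  have d5 := d (2 * n + 5) (by lia)
  generalize 1 - (p : ℝ)⁻¹ ^ (2 * n + 2) = A at *
  generalize 1 - (p : ℝ)⁻¹ ^ (2 * n + 3) = B at *
  generalize 1 - (p : ℝ)⁻¹ ^ (2 * n + 5) = C at *
  generalize 1 - (p : ℝ)⁻¹ ^ (2 * n + 4) = D at *
  field_simp
  ring

/-- The quotients at negative arguments give the same correction factor, the arithmetic counterpart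
of the inversion symmetry. -/
lemma padicGamma_ratio_neg {p : ℕ} (hp : 1 < p) (n : ℕ) :
    padicGamma p (-2 * (n + 1 : ℕ)) / padicGamma p (-2 * (n + 1 : ℕ) - 2) =
      (p : ℝ) ^ 2 * gammaCorrection (p : ℝ)⁻¹ n := by
  have hp1 : (1 : ℝ) < p := by exact_mod_cast hp
  have hp0 : (0 : ℝ) < p := by linarith
  have hv1 : (p : ℝ)⁻¹ < 1 := inv_lt_one_of_one_lt₀ hp1
  have hneg (m : ℕ) : (p : ℝ) ^ (-(m : ℝ)) = (p : ℝ)⁻¹ ^ m := by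
    rw [Real.rpow_neg hp0.le, Real.rpow_natCast, inv_pow]
  have hpos (m : ℕ) : 1 - (p : ℝ) ^ m = -((p : ℝ) ^ m * (1 - (p : ℝ)⁻¹ ^ m)) := by
    rw [mul_sub, ← mul_pow, mul_inv_cancel₀ hp0.ne', one_pow]; ring
  have d (m : ℕ) (hm : m ≠ 0) := (one_sub_pow_pos (inv_pos.2 hp0) hv1 hm).ne'
  rw [padicGamma, padicGamma,
    show (-2 * (n + 1 : ℕ) - 1 : ℝ) = -((2 * n + 3 : ℕ) : ℝ) by push_cast; ring,
    show (-2 * (n + 1 : ℕ) - 2 - 1 : ℝ) = -((2 * n + 5 : ℕ) : ℝ) by push_cast; ring,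
    show -(-2 * (n + 1 : ℕ) : ℝ) = ((2 * n + 2 : ℕ) : ℝ) by push_cast; ring,
    show -(-2 * (n + 1 : ℕ) - 2 : ℝ) = ((2 * n + 4 : ℕ) : ℝ) by push_cast; ring,
    Real.rpow_natCast, Real.rpow_natCast, hneg, hneg, hpos, hpos, gammaCorrection]
  have d2 := d (2 * n + 2) (by lia)
  have d4 := d (2 * n + 4) (by lia)
  have d5 := d (2 * n + 5) (by lia)
  generalize 1 - (p : ℝ)⁻¹ ^ (2 * n + 2) = A at *
  generalize 1 - (p : ℝ)⁻¹ ^ (2 * n + 3) = B at *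
  generalize 1 - (p : ℝ)⁻¹ ^ (2 * n + 5) = C at *
  generalize 1 - (p : ℝ)⁻¹ ^ (2 * n + 4) = D at *
  field_simp
  ring

/-- The even coefficients of the inner series. -/
def innerCoeff (v E : ℝ) (n : ℕ) : ℝ := v ^ n * innerSeq v E n

/-- The coefficients of the outer series `∑ eₙ |x|¹⁻²ⁿ`. -/
def outerCoeff (v E κ : ℝ) : ℕ → ℝ
  | 0 => 0
  | 1 => 0
  | n + 2 => κ * v⁻¹ ^ n * outerSeq v E n

/-- The sequence supported on even indices with values `a`. -/
def spreadEven (a : ℕ → ℝ) (j : ℕ) : ℝ := if Even j then a (j / 2) else 0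

/-- The sequence supported on odd indices with value `e m` at `2 m - 1`. -/
def spreadOdd (e : ℕ → ℝ) (j : ℕ) : ℝ := if Even j then 0 else e ((j + 1) / 2)

lemma spreadEven_two_mul (a : ℕ → ℝ) (n : ℕ) : spreadEven a (2 * n) = a n := by
  simp [spreadEven]

lemma spreadEven_odd (a : ℕ → ℝ) (n : ℕ) : spreadEven a (2 * n + 1) = 0 := by
  simp [spreadEven]

lemma spreadOdd_two_mul (e : ℕ → ℝ) (n : ℕ) : spreadOdd e (2 * n) = 0 := by
  simp [spreadOdd]

lemma spreadOdd_odd (e : ℕ → ℝ) (n : ℕ) : spreadOdd e (2 * n + 1) = e (n + 1) := by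
  rw [spreadOdd, if_neg (by simp)]
  congr 1
  lia

lemma support_subset_range_two_mul {f : ℕ → ℝ} (hf : ∀ n, f (2 * n + 1) = 0) :
    ∀ j ∉ Set.range (fun n : ℕ => 2 * n), f j = 0 := by
  intro j hj
  obtain ⟨m, rfl | rfl⟩ := j.even_or_odd'
  · exact absurd ⟨m, rfl⟩ hj
  · exact hf m

lemma summable_iff_of_odd_eq_zero {f : ℕ → ℝ} (hf : ∀ n, f (2 * n + 1) = 0) :
    Summable f ↔ Summable fun n => f (2 * n) :=
  ((mul_right_injective₀ two_ne_zero).summable_iff (support_subset_range_two_mul hf)).symm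

lemma tsum_of_odd_eq_zero {f : ℕ → ℝ} (hf : ∀ n, f (2 * n + 1) = 0) :
    ∑' n, f n = ∑' n, f (2 * n) := by
  refine ((mul_right_injective₀ two_ne_zero).tsum_eq (f := f) fun j hj => ?_).symm
  by_contra h
  exact hj (support_subset_range_two_mul hf j h)

lemma tsum_nat_add_of_eq_zero {f : ℕ → ℝ} (k : ℕ) (hf : ∀ n < k, f n = 0) :
    ∑' n, f n = ∑' n, f (n + k) := by
  refine ((add_left_injective k).tsum_eq (f := f) fun j hj => ?_).symm
  by_contra h
  exact hj (hf j (not_le.1 fun h' => h ⟨j - k, Nat.sub_add_cancel h'⟩))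

section

variable {p : ℕ} [hp : Fact p.Prime] {a e : ℕ → ℝ}

lemma outer_term (e : ℕ → ℝ) {X : ℝ} (hX : 0 < X) (n : ℕ) :
    spreadOdd e (2 * n + 1) * X ^ (-(((2 * n : ℕ) : ℤ) + 1)) =
      X * (e (n + 1) * X⁻¹ ^ (2 * (n + 1))) := by
  rw [spreadOdd_odd, show ((2 * n : ℕ) : ℤ) + 1 = (2 * n + 1 : ℕ) by push_cast; rfl, zpow_neg,
    zpow_natCast, inv_pow]
  field_simp
  ring

/-- Norms are discrete: one exceeding 1 is at least p. Hence the outer series only needs to converge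
at 1/p. -/
lemma inv_norm_le_of_one_lt {x : ℚ_[p]} (hx : 1 < ‖x‖) : ‖x‖⁻¹ ≤ (p : ℝ)⁻¹ := by
  have h0 : x ≠ 0 := norm_pos_iff.1 (by linarith)
  have hp1 := Nat.Prime.one_lt_cast_real (p := p)
  rw [Padic.norm_eq_zpow_neg_valuation h0] at hx ⊢
  rw [one_lt_zpow_iff_right₀ hp1] at hx
  gcongr
  simpa using zpow_le_zpow_right₀ hp1.le (by lia : (1 : ℤ) ≤ -x.valuation)

lemma psiZeroConvergesAt_spread (sa : Summable fun n => |a n|)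
    (se : Summable fun n => |e n| * (p : ℝ)⁻¹ ^ (2 * n)) (x : ℚ_[p]) :
    PsiZeroConvergesAt p (spreadEven a) (spreadOdd e) x := by
  have hodd : ∀ n, spreadOdd e (2 * n + 1 + 1) * gPow p (-(((2 * n + 1 : ℕ) : ℤ) + 1)) x = 0 :=
    fun n => by rw [show 2 * n + 1 + 1 = 2 * (n + 1) by ring, spreadOdd_two_mul, zero_mul]
  constructor
  · rw [summable_iff_of_odd_eq_zero fun n => by rw [spreadEven_odd, zero_mul]]
    by_cases hx : ‖x‖ ≤ 1
    · simp_rw [spreadEven_two_mul, fPow, if_pos hx]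
      exact summable_evenSeries (X₀ := 1) (by simpa using sa) (norm_nonneg _) hx
    · simp_rw [fPow, if_neg hx, mul_zero]
      exact summable_zero
  · rw [summable_iff_of_odd_eq_zero hodd]
    by_cases hx : ‖x‖ ≤ 1
    · simp_rw [gPow, if_pos hx, mul_zero]
      exact summable_zero
    · have hX : 0 < ‖x‖ := by linarith
      simp_rw [gPow, if_neg hx, outer_term e hX]
      exact ((summable_nat_add_iff 1).2 (summable_evenSeries se (by positivity)
        (inv_norm_le_of_one_lt (not_le.1 hx)))).mul_left ‖x‖

lemma psiZero_spread (he0 : e 0 = 0)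
    (se : Summable fun n => |e n| * (p : ℝ)⁻¹ ^ (2 * n)) (x : ℚ_[p]) :
    psiZero p (spreadEven a) (spreadOdd e) x = radialProfile a e ‖x‖ := by
  have hodd : ∀ n, spreadOdd e (2 * n + 1 + 1) * gPow p (-(((2 * n + 1 : ℕ) : ℤ) + 1)) x = 0 :=
    fun n => by rw [show 2 * n + 1 + 1 = 2 * (n + 1) by ring, spreadOdd_two_mul, zero_mul]
  rw [psiZero, tsum_of_odd_eq_zero (f := fun n => spreadEven a n * fPow p n x)
    fun n => by rw [spreadEven_odd, zero_mul],
    tsum_of_odd_eq_zero (f := fun n => spreadOdd e (n + 1) * gPow p (-((n : ℤ) + 1)) x) hodd,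
    radialProfile]
  by_cases hx : ‖x‖ ≤ 1
  · simp_rw [spreadEven_two_mul, fPow, gPow, if_pos hx, mul_zero, tsum_zero, add_zero]
    rfl
  · have hX : 0 < ‖x‖ := by linarith
    simp_rw [fPow, gPow, if_neg hx, outer_term e hX, mul_zero, tsum_zero, zero_add]
    rw [tsum_mul_left, evenSeries, ← (summable_evenSeries se (by positivity)
      (inv_norm_le_of_one_lt (not_le.1 hx))).sum_add_tsum_nat_add 1]
    simp [he0]

end

lemma isCoefficientPair_spread {p : ℕ} (hp : 1 < p) {E : ℝ} {a e : ℕ → ℝ}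
    (ha1 : a 1 = 0) (he1 : e 1 = 0) (he2 : e 2 = 0)
    (ra : ∀ n, a (n + 2) * ((p : ℝ) ^ 2 * gammaCorrection (p : ℝ)⁻¹ n) = E * a (n + 1) + a n)
    (re : ∀ n, e (n + 2) * ((p : ℝ) ^ 2 * gammaCorrection (p : ℝ)⁻¹ n) =
      e (n + 4) + E * e (n + 3)) :
    IsCoefficientPair p (-1) E (spreadEven a) (spreadOdd e) where
  c_odd := spreadEven_odd a
  c_two := (spreadEven_two_mul a 1).trans ha1
  c_rec n := by
    rw [show 2 * n + 4 = 2 * (n + 2) by ring, show 2 * n + 2 = 2 * (n + 1) by ring,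
      spreadEven_two_mul, spreadEven_two_mul, spreadEven_two_mul, padicGamma_ratio_pos hp, ra]
    ring
  k_even n _ := spreadOdd_two_mul e n
  k_one := (spreadOdd_odd e 0).trans he1
  k_three := (spreadOdd_odd e 1).trans he2
  k_rec n hn := by
    obtain ⟨m, rfl⟩ := Nat.exists_eq_add_of_le' hn
    rw [show 2 * (m + 1) + 5 = 2 * (m + 3) + 1 by ring,
      show 2 * (m + 1) + 3 = 2 * (m + 2) + 1 by ring,
      spreadOdd_odd, spreadOdd_odd, spreadOdd_odd, padicGamma_ratio_neg hp, re]
    ring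

section

variable {v E κ : ℝ}

lemma innerCoeff_rec (hv0 : 0 < v) (hv1 : v < 1) (n : ℕ) :
    innerCoeff v E (n + 2) * (v⁻¹ ^ 2 * gammaCorrection v n) =
      E * innerCoeff v E (n + 1) + innerCoeff v E n := by
  have := (gammaCorrection_mem hv0 hv1 n).1
  simp only [innerCoeff, innerSeq]
  field_simp
  ring

lemma outerCoeff_rec (hv0 : 0 < v) (n : ℕ) :
    outerCoeff v E κ (n + 2) * (v⁻¹ ^ 2 * gammaCorrection v n) =
      outerCoeff v E κ (n + 4) + E * outerCoeff v E κ (n + 3) := by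
  simp only [outerCoeff, outerSeq, pow_succ]
  field_simp
  ring

lemma summable_innerCoeff (hv0 : 0 < v) (hv : v ≤ 1 / 4) (hE : |E| ≤ 1) :
    Summable fun n => |innerCoeff v E n| := by
  refine (summable_of_abs_le_two_pow hv0 hv (abs_innerSeq_le hv0 (by linarith) hE)
    (q := fun _ => 1) (by simp) 0).1.abs.congr fun n => ?_
  rw [innerCoeff, mul_one, mul_comm]
  rfl

lemma summable_outerCoeff (hv0 : 0 < v) (hv : v ≤ 1 / 4) (hE : |E| ≤ 1) :
    Summable fun n => |outerCoeff v E κ n| * v ^ (2 * n) := by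
  rw [← summable_nat_add_iff 2]
  refine ((summable_of_abs_le_two_pow hv0 hv (abs_outerSeq_le hv0 (by linarith) hE)
    (q := fun _ => 1) (by simp) 0).1.abs.mul_left (|κ| * v ^ 4)).congr fun n => ?_
  rw [outerCoeff, abs_mul, abs_mul, abs_mul, abs_mul, abs_one, abs_of_pos (pow_pos hv0 _),
    abs_of_pos (pow_pos (inv_pos.2 hv0) _), inv_pow, add_zero,
    show 2 * (n + 2) = n + n + 4 by ring, pow_add, pow_add]
  field_simp

lemma lowSeries_innerCoeff (hv0 : 0 < v) :
    lowSeries v (innerCoeff v E) v⁻¹ = innerMass v E := by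
  rw [lowSeries, innerMass]
  congr 1
  funext n
  rw [innerCoeff, inv_pow, inv_mul_cancel_right₀ (by positivity)]
  simp only [add_zero]
  ring

lemma highSeries_innerCoeff : highSeries v (innerCoeff v E) 1 = innerTail v E := by
  rw [highSeries, innerTail]
  congr 1
  funext n
  rw [innerCoeff, one_pow]
  ring

lemma lowSeries_outerCoeff (hv0 : 0 < v) :
    lowSeries v (outerCoeff v E κ) 1 = κ * outerTail v E := by
  -- The first outer coefficient that can be nonzero has index 3, since index 2 carries t_0 = 0.
  rw [lowSeries, outerTail, tsum_nat_add_of_eq_zero 3 fun n hn => ?_, ← tsum_mul_left]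
  · congr 1
    funext n
    rw [show n + 3 = n + 1 + 2 by ring, outerCoeff, one_pow, inv_pow,
      show 2 * (n + 1 + 2) + 1 = 2 * (n + 1) + 5 by ring]
    have : v ^ (2 * (n + 1) + 5) = v ^ (n + 1) * v ^ (n + 1) * v ^ 5 := by ring
    generalize hd : 1 - v ^ (2 * (n + 1) + 5) = d
    rw [this]
    field_simp
  · interval_cases n <;> simp [outerCoeff, outerSeq]

lemma highSeries_outerCoeff (hv0 : 0 < v) :
    highSeries v (outerCoeff v E κ) v = κ * outerMass v E := by
  rw [highSeries, outerMass, tsum_nat_add_of_eq_zero 1 fun n hn => ?_, ← tsum_mul_left]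
  · congr 1
    funext n
    rw [outerCoeff, inv_pow]
    have : v ^ (2 * (n + 1) + 2) = v ^ (n + 1) * v ^ (n + 1) * v ^ 2 := by ring
    generalize hd : 1 - v ^ (2 * (n + 1) + 2) = d
    rw [this]
    field_simp
  · interval_cases n; simp [outerCoeff, outerSeq]

end

/-! ### Limits along the primes and the conclusion. -/

lemma eventually_largePrimes (P : ℕ) : ∀ᶠ p in largePrimes, P ≤ p :=
  (eventually_ge_atTop P).filter_mono inf_le_left

lemma isBigO_largePrimes {f g : ℕ → ℝ} {C : ℝ}
    (h : ∀ p : ℕ, 100 ≤ p → |f p| ≤ C * g p) : f =O[largePrimes] g := by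
  refine IsBigO.of_bound |C| ((eventually_largePrimes 100).mono fun p hp => ?_)
  rw [Real.norm_eq_abs, Real.norm_eq_abs, ← abs_mul]
  exact (h p hp).trans (le_abs_self _)

end

theorem theorem19 :
    ∃ (P : ℕ) (E : ℕ → ℝ) (c k : ℕ → ℕ → ℝ),
      (∀ (p : ℕ) [Fact p.Prime], P ≤ p →
        IsCoefficientPair p (-1) (E p) (c p) (k p) ∧ c p 0 ≠ 0 ∧ k p 5 ≠ 0 ∧
        (∀ x : ℚ_[p], PsiZeroConvergesAt p (c p) (k p) x) ∧
        IsPadicSchrodingerSolution p (-1) (E p) (fun x => (psiZero p (c p) (k p) x : ℂ))) ∧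
      (∀ n : ℕ, 1 ≤ n →
        (fun p : ℕ => c p (4 * n) / c p 0 - 1 / (p : ℝ) ^ (2 * n))
          =O[largePrimes] (fun p : ℕ => 1 / (p : ℝ) ^ (2 * n + 2))) ∧
      (∀ n : ℕ, 2 ≤ n →
        (fun p : ℕ => c p (4 * n + 2) / c p 0 - n * E p / (p : ℝ) ^ (2 * n + 2))
          =O[largePrimes] (fun p : ℕ => 1 / (p : ℝ) ^ (2 * n + 4))) ∧
      (∀ n : ℕ, 2 ≤ n →
        (fun p : ℕ => k p (4 * n + 1) / k p 5 - (p : ℝ) ^ (2 * n - 2))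
          =O[largePrimes] (fun p : ℕ => (p : ℝ) ^ (2 * n - 4))) ∧
      (∀ n : ℕ, 2 ≤ n →
        (fun p : ℕ => k p (4 * n + 3) / k p 5 - n * E p * (p : ℝ) ^ (2 * n - 2))
          =O[largePrimes] (fun p : ℕ => (p : ℝ) ^ (2 * n - 4))) := by
  have hv (p : ℕ) (hp : 100 ≤ p) : 0 < (p : ℝ)⁻¹ ∧ (p : ℝ)⁻¹ ≤ 1 / 100 := by
    have h : (100 : ℝ) ≤ p := by exact_mod_cast hp
    exact ⟨by positivity, by rw [inv_eq_one_div]; gcongr⟩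
  -- E and κ are chosen once for each p, so a single family serves all the asymptotic claims; below
  -- 100 the pair is arbitrary.
  have hex (p : ℕ) : ∃ z : ℝ × ℝ, 100 ≤ p →
      |z.1| ≤ 100 * (p : ℝ)⁻¹ ^ 2 ∧ z.2 ≠ 0 ∧
      padicDerivConst p * (z.2 * outerTail (p : ℝ)⁻¹ z.1 -
        (p : ℝ)⁻¹ ^ 2 / (1 - (p : ℝ)⁻¹ ^ 2) + innerTail (p : ℝ)⁻¹ z.1) = -z.1 ∧
      padicDerivConst p * (innerMass (p : ℝ)⁻¹ z.1 + z.2 * outerMass (p : ℝ)⁻¹ z.1) =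
        -(z.2 * p) := by
    by_cases hp : 100 ≤ p
    · obtain ⟨E, κ, h⟩ := exists_matching (hv p hp).1 (hv p hp).2
      rw [inv_inv] at h
      exact ⟨(E, κ), fun _ => h⟩
    · exact ⟨0, fun h => absurd h hp⟩
  choose z hz using hex
  set a : ℕ → ℕ → ℝ := fun p => innerCoeff (p : ℝ)⁻¹ (z p).1 with ha
  set e : ℕ → ℕ → ℝ := fun p => outerCoeff (p : ℝ)⁻¹ (z p).1 (z p).2 with he
  have hav (p n : ℕ) : a p n = (p : ℝ)⁻¹ ^ n * innerSeq (p : ℝ)⁻¹ (z p).1 n := rfl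
  have hev (p n : ℕ) : e p (n + 2) =
      (z p).2 * (p : ℝ) ^ n * outerSeq (p : ℝ)⁻¹ (z p).1 n := by
    simp only [he, outerCoeff, inv_inv]
  have hc0 (p : ℕ) : spreadEven (a p) 0 = 1 := by
    rw [show 0 = 2 * 0 by ring, spreadEven_two_mul]; simp [ha, innerCoeff, innerSeq]
  have hk5 (p : ℕ) : spreadOdd (e p) 5 = (z p).2 * p := by
    rw [show 5 = 2 * 2 + 1 by ring, spreadOdd_odd]; simp [he, outerCoeff, outerSeq]
  refine ⟨100, fun p => (z p).1, fun p => spreadEven (a p), fun p => spreadOdd (e p),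
    ?_, ?_, ?_, ?_, ?_⟩
  · intro p hpf hp
    obtain ⟨hv0, hv1⟩ := hv p hp
    obtain ⟨hE, hκ, hin, hout⟩ := hz p hp
    have hE1 : |(z p).1| ≤ 1 := by nlinarith
    have ra := innerCoeff_rec (E := (z p).1) hv0 (by linarith)
    have re := outerCoeff_rec (E := (z p).1) (κ := (z p).2) hv0
    simp_rw [inv_inv] at ra re
    have sa : Summable fun n => |a p n| := summable_innerCoeff hv0 (by linarith) hE1
    have se : Summable fun n => |e p n| * (p : ℝ)⁻¹ ^ (2 * n) :=
      summable_outerCoeff hv0 (by linarith) hE1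
    have ha1 : a p 1 = 0 := by simp [ha, innerCoeff, innerSeq]
    have he2 : e p 2 = 0 := by simp [he, outerCoeff, outerSeq]
    have he3 : e p 3 = (z p).2 * p := by simp [he, outerCoeff, outerSeq]
    have hl := lowSeries_innerCoeff (E := (z p).1) hv0
    rw [inv_inv] at hl
    refine ⟨isCoefficientPair_spread hpf.out.one_lt ha1 rfl he2 ra re, ?_, ?_,
      psiZeroConvergesAt_spread sa se, ?_⟩
    · beta_reduce; rw [hc0]; exact one_ne_zero
    · beta_reduce; rw [hk5]; exact mul_ne_zero hκ (by exact_mod_cast hpf.out.ne_zero)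
    · refine isPadicSchrodingerSolution_of_matching p ha1 rfl rfl he2 ra re sa se ?_ ?_
        (psiZero_spread rfl se)
      · have ha0 : a p 0 = 1 := by simp [ha, innerCoeff, innerSeq]
        rw [ha0, lowSeries_outerCoeff hv0, highSeries_innerCoeff, one_mul, mul_one]
        exact hin
      · rw [hl, highSeries_outerCoeff hv0, he3]
        exact hout
  · intro n _
    obtain ⟨C, hC, h⟩ := innerSeq_asymptotics (M := 100) (by norm_num) n
    refine isBigO_largePrimes (C := C) fun p hp => ?_
    obtain ⟨hv0, hv1⟩ := hv p hp
    have := (h _ _ hv0 (by linarith) (hz p hp).1).1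
    beta_reduce
    rw [hc0, div_one, show 4 * n = 2 * (2 * n) by ring, spreadEven_two_mul, hav,
      one_div, one_div, ← inv_pow, ← inv_pow]
    calc _ = |(p : ℝ)⁻¹ ^ (2 * n) * (innerSeq (p : ℝ)⁻¹ (z p).1 (2 * n) - 1)| := by
          congr 1; ring
      _ ≤ (p : ℝ)⁻¹ ^ (2 * n) * (C * (p : ℝ)⁻¹ ^ 2) := by
          rw [abs_mul, abs_of_pos (pow_pos hv0 _)]; gcongr
      _ = _ := by ring
  · intro n _
    obtain ⟨C, hC, h⟩ := innerSeq_asymptotics (M := 100) (by norm_num) n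
    -- The coefficient and the main term nE_p/p^(2n+2) are each O(p^(-2n-4)): C bounds the first,
    -- and n · 100 the second through |E_p| ≤ 100/p².
    refine isBigO_largePrimes (C := C + n * 100) fun p hp => ?_
    obtain ⟨hv0, hv1⟩ := hv p hp
    have hE := (hz p hp).1
    have := (h _ _ hv0 (by linarith) hE).2
    beta_reduce
    rw [hc0, div_one, show 4 * n + 2 = 2 * (2 * n + 1) by ring, spreadEven_two_mul, hav,
      one_div, div_eq_mul_inv, ← inv_pow, ← inv_pow]
    calc _ ≤ |(p : ℝ)⁻¹ ^ (2 * n + 1) * innerSeq (p : ℝ)⁻¹ (z p).1 (2 * n + 1)| +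
          |n * (z p).1 * (p : ℝ)⁻¹ ^ (2 * n + 2)| := abs_sub _ _
      _ ≤ (p : ℝ)⁻¹ ^ (2 * n + 1) * (C * (p : ℝ)⁻¹ ^ 3) +
          n * (100 * (p : ℝ)⁻¹ ^ 2) * (p : ℝ)⁻¹ ^ (2 * n + 2) := by
          rw [abs_mul, abs_mul, abs_mul, abs_of_pos (pow_pos hv0 _),
            abs_of_pos (pow_pos hv0 _), Nat.abs_cast]
          gcongr
      _ = _ := by ring
  · intro n hn
    -- Writing n = m + 2 makes the truncated exponents 2n − 2 and 2n − 4 genuine differences.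
    obtain ⟨m, rfl⟩ := Nat.exists_eq_add_of_le' hn
    obtain ⟨C, hC, h⟩ := outerSeq_asymptotics (M := 100) (by norm_num) (m + 1)
    refine isBigO_largePrimes (C := C) fun p hp => ?_
    obtain ⟨hv0, hv1⟩ := hv p hp
    have := (h _ _ hv0 (by linarith) (hz p hp).1).2
    have hκ := (hz p hp).2.1
    have hp0 : (0 : ℝ) < p := inv_pos.1 hv0
    beta_reduce
    rw [hk5, show 4 * (m + 2) + 1 = 2 * (2 * (m + 1) + 2) + 1 by ring, spreadOdd_odd,
      show 2 * (m + 1) + 2 + 1 = 2 * (m + 1) + 1 + 2 by ring, hev,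
      show 2 * (m + 2) - 2 = 2 * m + 2 by lia, show 2 * (m + 2) - 4 = 2 * m by lia]
    calc _ = |(p : ℝ) ^ (2 * m + 2) * (outerSeq (p : ℝ)⁻¹ (z p).1 (2 * (m + 1) + 1) - 1)| := by
          congr 1
          field_simp
          ring
      _ ≤ (p : ℝ) ^ (2 * m + 2) * (C * (p : ℝ)⁻¹ ^ 2) := by
          rw [abs_mul, abs_of_pos (pow_pos hp0 _)]; gcongr
      _ = _ := by field_simp; ring
  · intro n hn
    obtain ⟨m, rfl⟩ := Nat.exists_eq_add_of_le' hn
    obtain ⟨C, hC, h⟩ := outerSeq_asymptotics (M := 100) (by norm_num) (m + 2)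
    -- Again both terms are separately within the error O(p^(2n-4)), by the odd-parity smallness v³
    -- and by |E_p| ≤ 100/p².
    refine isBigO_largePrimes (C := C + (m + 2 : ℕ) * 100) fun p hp => ?_
    obtain ⟨hv0, hv1⟩ := hv p hp
    have hE := (hz p hp).1
    have := (h _ _ hv0 (by linarith) hE).1
    have hκ := (hz p hp).2.1
    have hp0 : (0 : ℝ) < p := inv_pos.1 hv0
    beta_reduce
    rw [hk5, show 4 * (m + 2) + 3 = 2 * (2 * (m + 2) + 1) + 1 by ring, spreadOdd_odd,
      hev, show 2 * (m + 2) - 2 = 2 * m + 2 by lia, show 2 * (m + 2) - 4 = 2 * m by lia]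
    calc _ = |(p : ℝ) ^ (2 * m + 3) * outerSeq (p : ℝ)⁻¹ (z p).1 (2 * (m + 2)) -
          (m + 2 : ℕ) * (z p).1 * (p : ℝ) ^ (2 * m + 2)| := by
          congr 1
          field_simp
          ring
      _ ≤ |(p : ℝ) ^ (2 * m + 3) * outerSeq (p : ℝ)⁻¹ (z p).1 (2 * (m + 2))| +
          |(m + 2 : ℕ) * (z p).1 * (p : ℝ) ^ (2 * m + 2)| := abs_sub _ _
      _ ≤ (p : ℝ) ^ (2 * m + 3) * (C * (p : ℝ)⁻¹ ^ 3) +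
          (m + 2 : ℕ) * (100 * (p : ℝ)⁻¹ ^ 2) * (p : ℝ) ^ (2 * m + 2) := by
          rw [abs_mul, abs_mul, abs_mul, abs_of_pos (pow_pos hp0 _),
            abs_of_pos (pow_pos hp0 _), Nat.abs_cast]
          gcongr
      _ = _ := by field_simp; ring
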